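/- Let $N\ge 1$, $\alpha\in(0,1)$, $T>0$, and let $(\Omega,\mathcal F,\mathbb P)$ be a complete probability space carrying independent Brownian motions $\beta^1,\dots,\beta^N$ and a strictly $\alpha$-stable subordinator $L$ independent of them, i.e. $L$ is an increasing Lévy process with $$\mathbb E\left[e^{iuL_1}\right]=\exp\left\{-\bar\gamma^\alpha|u|^\alpha\left(1-i\tan\tfrac{\pi\alpha}{2}\,\mathrm{sign}\,u\right)\right\},\quad u\in\mathbb R,\text{ for some }\bar\gamma>0.$$ Write $W=(\beta^1,\dots,\beta^N)^\top$ and endow $\Omega$ with the minimal augmented filtration generated by $W_L=(W_{L_t})_{t\ge0}$. Let $A=-\mathrm{diag}[\lambda_1,\dots,\lambda_N]$ and $Q=\mathrm{diag}[\sigma_1^2,\dots,\sigma_N^2]$ with $\lambda_i>0$, $\sigma_i>0$. Let $n\ge2$ be an integer. Let $B_0\in C_b^{0,n}([0,T]\times\mathbb R^N;\mathbb R^N)$: $B_0$ is continuous, $B_0(t,\cdot)$ is $n$ times continuously differentiable for every $t\in[0,T]$, and $B_0$ and its partial derivatives in $x$ up to order $n$ are bounded on $[0,T]\times\mathbb R^N$.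 For $0\le s\le T$ and $x\in\mathbb R^N$ let $X^{s,x}=(X^{s,x}_t)_{t\in[s,T]}$ be the adapted càdlàg solution (unique up to indistinguishability) of $$dX^{s,x}_t=\left(AX^{s,x}_t+B_0(t,X^{s,x}_t)\right)dt+\sqrt Q\,dW_{L_t},\qquad X^{s,x}_s=x,$$ and put $P_{s,t}\phi(x)=\mathbb E[\phi(X^{s,x}_t)]$ for $0\le s\le t\le T$ and $\phi:\mathbb R^N\to\mathbb R$ bounded and Borel. Let $C_b^n(\mathbb R^N)$ be the space of bounded, $n$ times continuously differentiable functions $\mathbb R^N\to\mathbb R$ whose partial derivatives up to order $n$ are bounded, and let $\|\partial^i\psi\|_\infty$ be the maximum of the supremum norms of the partial derivatives of $\psi$ of order $i$. If $\phi\in C_b^n(\mathbb R^N)$, then $P_{s,t}\phi\in C_b^n(\mathbb R^N)$ for all $0\le s\le t\le T$, and $$\sup_{0\le s\le t\le T}\left(\|P_{s,t}\phi\|_\infty+\sum_{i=1}^n\|\partial^iP_{s,t}\phi\|_\infty\right)<\infty.$$ -/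

import Mathlib

open MeasureTheory ProbabilityTheory Set Filter Topology
open scoped NNReal ENNReal

/-! ### Spaces of bounded differentiable functions -/

/-- `C_b^k`: the functions that are bounded and `k` times continuously differentiable with bounded
derivatives up to order `k`. The derivative of order `0` is the function itself. -/
structure IsCb {E F : Type*} [NormedAddCommGroup E] [NormedSpace ℝ E]
    [NormedAddCommGroup F] [NormedSpace ℝ F] (k : ℕ) (f : E → F) : Prop where
  contDiff : ContDiff ℝ k f
  bounded : ∀ i ≤ k, ∃ C : ℝ, ∀ x, ‖iteratedFDeriv ℝ i f x‖ ≤ C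

/-- `C_b^{0,k}([0,T] × E; F)`: continuous in time and space, `k` times continuously
differentiable in space, with the function and its spatial derivatives up to order `k` bounded on
`[0,T] × E`. The values of `B` at times outside `[0,T]` play no role. -/
structure IsCbZero {E F : Type*} [NormedAddCommGroup E] [NormedSpace ℝ E]
    [NormedAddCommGroup F] [NormedSpace ℝ F] (k : ℕ) (T : ℝ) (B : ℝ → E → F) : Prop where
  continuousOn : ContinuousOn (fun p : ℝ × E => B p.1 p.2) (Icc 0 T ×ˢ univ)
  contDiff : ∀ t ∈ Icc 0 T, ContDiff ℝ k (B t)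
  bounded : ∀ i ≤ k, ∃ C : ℝ, ∀ t ∈ Icc 0 T, ∀ x, ‖iteratedFDeriv ℝ i (B t) x‖ ≤ C

/-- The partial derivative `∂_{j 0} ⋯ ∂_{j (h-1)} f` of order `h` of a scalar function. Every
multi-index of length `h` is represented by some `j`. -/
noncomputable def partialDeriv {N h : ℕ} (j : Fin h → Fin N)
    (f : EuclideanSpace ℝ (Fin N) → ℝ) (x : EuclideanSpace ℝ (Fin N)) : ℝ :=
  iteratedFDeriv ℝ h f x (fun l => EuclideanSpace.single (j l) (1 : ℝ))

/-- The supremum norm of a scalar function, with values in `[0, ∞]`. -/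
noncomputable def supNorm {E : Type*} (f : E → ℝ) : ℝ≥0∞ := ⨆ x, ‖f x‖ₑ

/-- The norm `‖f‖_∞ + ∑_{i=1}^n ‖∂^i f‖_∞`, with values in `[0, ∞]`, where `‖∂^i f‖_∞` is the
largest supremum norm of a partial derivative of order `i`. -/
noncomputable def cbNorm {N : ℕ} (n : ℕ) (f : EuclideanSpace ℝ (Fin N) → ℝ) : ℝ≥0∞ :=
  supNorm f + ∑ i ∈ Finset.Icc 1 n, ⨆ j : Fin i → Fin N, supNorm (partialDeriv j f)

/-! ### The driving noise -/

/-- Right-continuity and existence of left limits, relative to the index set `I`. -/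
def IsCadlagOn {ι E : Type*} [TopologicalSpace ι] [Preorder ι] [TopologicalSpace E]
    (f : ι → E) (I : Set ι) : Prop :=
  ∀ r ∈ I, ContinuousWithinAt f (I ∩ Ioi r) r ∧ ∃ l, Tendsto f (𝓝[I ∩ Iio r] r) (𝓝 l)

/-- A real Lévy process: it starts at zero, has independent and stationary increments, and its
paths are almost surely càdlàg. -/
structure IsLevyProcess {Ω : Type*} [MeasurableSpace Ω] (X : ℝ≥0 → Ω → ℝ) (μ : Measure Ω) :
    Prop where
  measurable : ∀ t, Measurable (X t)
  zero : ∀ᵐ ω ∂μ, X 0 ω = 0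
  indep : HasIndepIncrements X μ
  stationary : ∀ s t, IdentDistrib (fun ω => X (s + t) ω - X s ω) (X t) μ μ
  cadlag : ∀ᵐ ω ∂μ, IsCadlagOn (fun t => X t ω) univ

/-- A strictly `α`-stable subordinator: an increasing Lévy process whose characteristic function
at time `1` is `exp (-γ^α |u|^α (1 - i tan (π α / 2) sign u))` for some `γ > 0`. -/
structure IsStableSubordinator {Ω : Type*} [MeasurableSpace Ω] (α : ℝ) (L : ℝ≥0 → Ω → ℝ≥0)
    (μ : Measure Ω) : Prop where
  levy : IsLevyProcess (fun t ω => (L t ω : ℝ)) μ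
  mono : ∀ᵐ ω ∂μ, Monotone (fun t => L t ω)
  charFun_one : ∃ γ : ℝ, 0 < γ ∧ ∀ u : ℝ,
    ∫ ω, Complex.exp (Complex.I * ((u * (L 1 ω : ℝ) : ℝ) : ℂ)) ∂μ =
      Complex.exp (-((γ ^ α * |u| ^ α : ℝ) : ℂ) *
        (1 - Complex.I * ((Real.tan (Real.pi * α / 2) * Real.sign u : ℝ) : ℂ)))

/-- The subordinated process `W_L`, that is `t ↦ W_{L_t}` with `W = (β^1, …, β^N)`. -/
def subordinated {Ω : Type*} {N : ℕ} (β : Fin N → ℝ≥0 → Ω → ℝ) (L : ℝ≥0 → Ω → ℝ≥0)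
    (t : ℝ≥0) (ω : Ω) : EuclideanSpace ℝ (Fin N) :=
  WithLp.toLp 2 (fun i => β i (L t ω) ω)

/-- The minimal augmented filtration generated by a process `Z`: at time `t`, the σ-algebra
generated by `Z u`, `u ≤ t`, and by the negligible sets. -/
abbrev augmentedFiltration {Ω E : Type*} [MeasurableSpace Ω] [MeasurableSpace E]
    (Z : ℝ≥0 → Ω → E) (μ : Measure Ω) (t : ℝ≥0) : MeasurableSpace Ω :=
  (⨆ u : Iic t, MeasurableSpace.comap (Z u) inferInstance) ⊔
    MeasurableSpace.generateFrom {S : Set Ω | μ S = 0}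

/-- The standing assumptions on the noise: `β^1, …, β^N` are independent Brownian motions and `L`
is a strictly `α`-stable subordinator independent from `(β^1, …, β^N)`. -/
structure IsNoise {Ω : Type*} [MeasurableSpace Ω] {N : ℕ} (α : ℝ) (β : Fin N → ℝ≥0 → Ω → ℝ)
    (L : ℝ≥0 → Ω → ℝ≥0) (μ : Measure Ω) : Prop where
  brownian : ∀ i, IsBrownianReal (β i) μ
  indep_brownian : iIndepFun (fun i ω t => β i t ω) μ
  subordinator : IsStableSubordinator α L μ
  indep : IndepFun (fun ω t => L t ω) (fun ω i t => β i t ω) μ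

/-! ### The stochastic differential equation -/

/-- The diagonal matrix with entries `c`, acting on `ℝ^N`. -/
noncomputable def diagOp {N : ℕ} (c : Fin N → ℝ) :
    EuclideanSpace ℝ (Fin N) →L[ℝ] EuclideanSpace ℝ (Fin N) :=
  Matrix.toEuclideanCLM (𝕜 := ℝ) (Matrix.diagonal c)

/-- `X` solves, on `[s,T]` and with `X_s = x`, the equation
`dX_t = (A X_t + B (t, X_t)) dt + √Q dZ_t`, where `A = -diag (lam_1, …, lam_N)` and
`Q = diag (σ_1^2, …, σ_N^2)` with `σ_i > 0`: it is adapted to the minimal augmented filtration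
generated by `Z`, almost surely càdlàg, and almost surely satisfies the integral equation
simultaneously at all times `t ∈ [s,T]`. -/
structure IsSDESolution {Ω : Type*} [MeasurableSpace Ω] {N : ℕ} (μ : Measure Ω)
    (Z : ℝ≥0 → Ω → EuclideanSpace ℝ (Fin N)) (lam σ : Fin N → ℝ)
    (B : ℝ → EuclideanSpace ℝ (Fin N) → EuclideanSpace ℝ (Fin N)) (T s : ℝ)
    (x : EuclideanSpace ℝ (Fin N)) (X : ℝ → Ω → EuclideanSpace ℝ (Fin N)) : Prop where
  adapted : ∀ t ∈ Icc s T, Measurable[augmentedFiltration Z μ t.toNNReal] (X t)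
  cadlag : ∀ᵐ ω ∂μ, IsCadlagOn (fun t => X t ω) (Icc s T)
  equation : ∀ᵐ ω ∂μ, ∀ t ∈ Icc s T,
    X t ω = x + (∫ r in s..t, (diagOp (fun i => -lam i) (X r ω) + B r (X r ω)))
      + diagOp σ (Z t.toNNReal ω - Z s.toNNReal ω)

/-- The transition operators `P_{s,t} φ (x) = E[φ (X^{s,x}_t)]` of the family `X^{s,x}`. -/
noncomputable def transitionOp {Ω E : Type*} [MeasurableSpace Ω] (μ : Measure Ω)
    (X : ℝ → E → ℝ → Ω → E) (s t : ℝ) (φ : E → ℝ) (x : E) : ℝ :=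
  ∫ ω, φ (X s x t ω) ∂μ

/-! The noise is additive, so it cancels in the difference of two solutions. With `ξ = X^{s,0}`, the
path `V = X^{s,x} - ξ` solves, for almost every `ω`, the ordinary equation `V_t = x + ∫_s^t (A V_r +
B(r, ξ_r + V_r) - B(r, ξ_r)) dr` (`eq_add_flow`). Its right-hand side vanishes at `V = 0`, and its
derivatives in `V` are those of `A` and `B` at a translated point. They are therefore bounded
uniformly in `s`, `r` and the path `ξ` (`isCbFamily_pathField`), while `ξ` itself may be arbitrarily
large.

A flow driven by such a field has spatial derivatives of orders `1, …, n` bounded by deterministic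
constants (`exists_flow`). The first derivative solves the linearised equation; regularity then
rises one order at a time, because a linear integral equation passes the regularity of its
coefficients on to its solution (`isCbFamily_of_linear`). These steps rest on Grönwall's inequality
and on Picard iteration with coefficients that are merely measurable in time, since `ξ` jumps.

Finally `X^{s,x}_t = ξ_t + Y_t(x)`, so `φ(X^{s,x}_t)` has derivatives in `x` bounded uniformly in
`ω`, `s`, `t`, and `IsCbFamily.integral` moves them under the expectation. `IsCbFamily` carries the
uniformity throughout. Its lower order `l` is `0` for bounded objects and `1` for those, such as the
flow, of which only the derivatives are bounded. -/

/-! ### Integral equations with a measurable time dependence -/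

/-- Lebesgue measure on the time interval `(0, T]`. -/
noncomputable def timeMeasure (T : ℝ) : Measure ℝ := volume.restrict (Ioc 0 T)

instance (T : ℝ) : IsFiniteMeasure (timeMeasure T) := by
  unfold timeMeasure; infer_instance

/-- The exponential weight for which the Volterra operator with constant `K` on `(0, T]` is a
contraction. -/
noncomputable def expWeight (K T t : ℝ) : ℝ := Real.exp (2 * K * max 0 (min t T))

lemma continuous_expWeight (K T : ℝ) : Continuous (expWeight K T) := by
  unfold expWeight; fun_prop

lemma one_le_expWeight {K : ℝ} (hK : 0 ≤ K) (T t : ℝ) : 1 ≤ expWeight K T t :=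
  Real.one_le_exp (by positivity)

lemma expWeight_le {K T : ℝ} (hK : 0 ≤ K) (hT : 0 ≤ T) (t : ℝ) :
    expWeight K T t ≤ Real.exp (2 * K * T) := by
  unfold expWeight
  gcongr
  exact max_le hT (min_le_right _ _)

/-- Integrals over `Iic t` against `timeMeasure T` are defined for every real `t`: they vanish for
`t ≤ 0` and are constant after `T`. The integral equations can thus be imposed at all times, with no
side condition on `t`. -/
lemma timeMeasure_restrict_Iic (T t : ℝ) :
    (timeMeasure T).restrict (Iic t) = volume.restrict (Ioc 0 (min t T)) := by
  rw [timeMeasure, Measure.restrict_restrict measurableSet_Iic]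
  congr 1
  ext x
  simp only [mem_inter_iff, mem_Iic, mem_Ioc, le_min_iff]
  tauto

/-- The rate `2K` in the weight makes `K ∫ e^{2Kr} dr` at most half of `e^{2Kt}`. This factor `1/2`
is the contraction behind both Grönwall and Picard below. -/
lemma integral_expWeight_le {K T : ℝ} (hK : 0 ≤ K) (t : ℝ) :
    K * ∫ r in Iic t, expWeight K T r ∂(timeMeasure T) ≤ expWeight K T t / 2 := by
  rw [timeMeasure_restrict_Iic]
  rcases lt_or_ge (min t T) 0 with hm | hm
  · rw [Ioc_eq_empty (by linarith), Measure.restrict_empty, integral_zero_measure, mul_zero]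
    have := one_le_expWeight hK T t
    positivity
  · have h1 : ∫ r in Ioc 0 (min t T), expWeight K T r
        = ∫ r in Ioc 0 (min t T), Real.exp (2 * K * r) := by
      refine setIntegral_congr_fun measurableSet_Ioc fun r hr => ?_
      rw [expWeight, min_eq_left (hr.2.trans (min_le_right _ _)), max_eq_right hr.1.le]
    have h2 : ∫ r in (0 : ℝ)..(min t T), K * Real.exp (2 * K * r)
        = Real.exp (2 * K * (min t T)) / 2 - Real.exp (2 * K * 0) / 2 := by
      refine intervalIntegral.integral_eq_sub_of_hasDerivAt
        (f := fun r => Real.exp (2 * K * r) / 2) (fun r _ => ?_)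
        (Continuous.intervalIntegrable (by fun_prop) _ _)
      have := (((hasDerivAt_id r).const_mul (2 * K)).exp).div_const 2
      exact this.congr_deriv (by simp only [id]; ring)
    rw [h1, ← integral_const_mul, ← intervalIntegral.integral_of_le hm, h2]
    simp only [expWeight]
    rw [max_eq_right hm, mul_zero, Real.exp_zero]
    linarith

lemma integral_Iic_le_of_nonneg {T : ℝ} {e : ℝ → ℝ} (he : Integrable e (timeMeasure T))
    (he0 : ∀ r, 0 ≤ e r) (t : ℝ) :
    ∫ r in Iic t, e r ∂(timeMeasure T) ≤ ∫ r, e r ∂(timeMeasure T) :=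
  setIntegral_le_integral he (Eventually.of_forall he0)

lemma integral_timeMeasure_const_le {T : ℝ} (hT : 0 ≤ T) (c : ℝ) :
    ∫ _, c ∂(timeMeasure T) = c * T := by
  simp [timeMeasure, measureReal_def, hT, mul_comm]

/-- The integral form of Grönwall's inequality for bounded functions. -/
lemma le_of_le_add_integral {K T a C : ℝ} (hK : 0 ≤ K) (ha : 0 ≤ a) {u : ℝ → ℝ}
    (hu : AEStronglyMeasurable u (timeMeasure T)) (hC : ∀ t, |u t| ≤ C)
    (h : ∀ t, u t ≤ a + K * ∫ r in Iic t, u r ∂(timeMeasure T)) (t : ℝ) :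
    u t ≤ 2 * a * expWeight K T t := by
  have hui : Integrable u (timeMeasure T) :=
    Integrable.of_bound hu C (Eventually.of_forall hC)
  have hwi : Integrable (expWeight K T) (timeMeasure T) := by
    unfold timeMeasure
    exact ((continuous_expWeight K T).continuousOn.integrableOn_Icc (a := 0) (b := T)).mono_set
      Ioc_subset_Icc_self
  have hC0 : 0 ≤ C := (abs_nonneg _).trans (hC 0)
  -- Inserting a bound `c * expWeight` into the hypothesis returns `(a + c / 2) * expWeight`, since
  -- the weight is at least `1`. Iterating from `C + 2a` drives `c` to the fixed point `2a`.
  have key : ∀ k : ℕ, ∀ t, u t ≤ (C / 2 ^ k + 2 * a) * expWeight K T t := by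
    intro k
    induction k with
    | zero =>
      intro t
      have h1 := one_le_expWeight hK T t
      have h2 := (le_abs_self _).trans (hC t)
      simp only [pow_zero, div_one]
      nlinarith
    | succ k ih =>
      intro t
      have h1 := one_le_expWeight hK T t
      have h2 : ∫ r in Iic t, u r ∂(timeMeasure T)
          ≤ ∫ r in Iic t, (C / 2 ^ k + 2 * a) * expWeight K T r ∂(timeMeasure T) :=
        integral_mono hui.integrableOn (hwi.integrableOn.const_mul _) ih
      rw [integral_const_mul] at h2
      have h3 := integral_expWeight_le (T := T) hK t
      have h4 : 0 ≤ C / 2 ^ k + 2 * a := by positivity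
      have h5 := mul_le_mul_of_nonneg_left h2 hK
      have h6 := mul_le_mul_of_nonneg_left h3 h4
      have h7 : C / 2 ^ (k + 1) = C / 2 ^ k / 2 := by rw [pow_succ, div_div]
      have h8 := h t
      rw [h7]
      nlinarith
  have hlim : Tendsto (fun k : ℕ => (C / 2 ^ k + 2 * a) * expWeight K T t) atTop
      (𝓝 ((0 + 2 * a) * expWeight K T t)) := by
    refine Tendsto.mul_const _ (Tendsto.add_const _ ?_)
    have := (tendsto_pow_atTop_nhds_zero_of_lt_one (r := (1 / 2 : ℝ)) (by norm_num)
      (by norm_num)).const_mul C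
    simpa [div_eq_mul_inv] using this
  have := ge_of_tendsto' hlim fun k => key k t
  simpa using this

section Volterra

variable {F : Type*} [NormedAddCommGroup F] [NormedSpace ℝ F]

/-- Grönwall's inequality for an integral equation in a normed space. -/
lemma norm_le_of_eq_add_integral {K T : ℝ} (hK : 0 ≤ K) (hT : 0 ≤ T) {C : ℝ} {u A : ℝ → F}
    {u₀ : F} {e : ℝ → ℝ} (hu : StronglyMeasurable u) (hC : ∀ t, ‖u t‖ ≤ C)
    (he : Integrable e (timeMeasure T)) (he0 : ∀ r, 0 ≤ e r)
    (hA : ∀ r, ‖A r‖ ≤ K * ‖u r‖ + e r)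
    (h : ∀ t, u t = u₀ + ∫ r in Iic t, A r ∂(timeMeasure T)) (t : ℝ) :
    ‖u t‖ ≤ 2 * Real.exp (2 * K * T) * (‖u₀‖ + ∫ r, e r ∂(timeMeasure T)) := by
  have hui : Integrable (fun r => ‖u r‖) (timeMeasure T) :=
    Integrable.of_bound hu.norm.aestronglyMeasurable C (Eventually.of_forall fun t => by
      simpa using hC t)
  have hE : 0 ≤ ∫ r, e r ∂(timeMeasure T) := integral_nonneg he0
  have := le_of_le_add_integral (T := T) (a := ‖u₀‖ + ∫ r, e r ∂(timeMeasure T)) (C := C) hK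
    (by positivity) hu.norm.aestronglyMeasurable (fun t => by simpa using hC t) (fun t => by
      rw [h t]
      refine (norm_add_le _ _).trans ?_
      rw [add_assoc]
      gcongr
      calc ‖∫ r in Iic t, A r ∂(timeMeasure T)‖
          ≤ ∫ r in Iic t, (K * ‖u r‖ + e r) ∂(timeMeasure T) :=
            norm_integral_le_of_norm_le ((hui.const_mul K).add he).integrableOn
              (Eventually.of_forall hA)
        _ = K * (∫ r in Iic t, ‖u r‖ ∂(timeMeasure T)) + ∫ r in Iic t, e r ∂(timeMeasure T) := by
            rw [integral_add (hui.const_mul K).integrableOn he.integrableOn, integral_const_mul]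
        _ ≤ _ := by
            rw [add_comm]
            exact add_le_add_left (integral_Iic_le_of_nonneg he he0 t) _) t
  refine this.trans ?_
  have h2 := expWeight_le hK hT t
  calc _ ≤ 2 * (‖u₀‖ + ∫ r, e r ∂(timeMeasure T)) * Real.exp (2 * K * T) := by gcongr
    _ = _ := by ring

/-- Continuity in `t` supplies the measurability of each Picard iterate. -/
lemma continuous_integral_Iic {T : ℝ} {g : ℝ → F} (hg : Integrable g (timeMeasure T)) :
    Continuous fun t => ∫ r in Iic t, g r ∂(timeMeasure T) := by
  have hg' : Integrable ((Ioc 0 T).indicator g) := by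
    rw [integrable_indicator_iff measurableSet_Ioc]; exact hg
  have h : (fun t => ∫ r in Iic t, g r ∂(timeMeasure T))
      = fun t => ∫ r in (0 : ℝ)..(max 0 t), (Ioc 0 T).indicator g r := by
    funext t
    rw [timeMeasure_restrict_Iic, intervalIntegral.integral_of_le (le_max_left _ _),
      setIntegral_indicator measurableSet_Ioc, Ioc_inter_Ioc]
    congr 2
    ext x
    simp only [mem_Ioc, le_min_iff, le_max_iff, sup_idem]
    constructor
    · tauto
    · rintro ⟨h1, h2 | h2, h3⟩
      · linarith
      · exact ⟨h1, h2, h3⟩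
  rw [h]
  exact (hg'.continuous_primitive 0).comp (continuous_const.max continuous_id)

/-- A function that is measurable in the parameter and continuous in the variable can be composed
with a measurable function. -/
lemma stronglyMeasurable_caratheodory {α G : Type*} [MeasurableSpace α] [FiniteDimensional ℝ F]
    [TopologicalSpace G] [TopologicalSpace.PseudoMetrizableSpace G] {f : α → F → G}
    (hf : ∀ y, StronglyMeasurable fun r => f r y)
    (hc : ∀ r, Continuous (f r)) {Z : α → F} (hZ : StronglyMeasurable Z) :
    StronglyMeasurable fun r => f r (Z r) := by
  borelize F
  have : ProperSpace F := FiniteDimensional.proper ℝ F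
  exact (stronglyMeasurable_uncurry_of_continuous_of_stronglyMeasurable (u := fun y r => f r y)
    hc hf).comp_measurable (hZ.measurable.prodMk measurable_id)

/-- Picard–Lindelöf for an integral equation whose right-hand side is only measurable in time. -/
lemma exists_eq_add_integral [FiniteDimensional ℝ F] {K T C : ℝ} (hK : 0 ≤ K) (hT : 0 ≤ T)
    {f : ℝ → F → F} (hf : ∀ y, StronglyMeasurable fun r => f r y)
    (hL : ∀ r y z, ‖f r y - f r z‖ ≤ K * ‖y - z‖) (h0 : ∀ r, ‖f r 0‖ ≤ C) (y₀ : F) :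
    ∃ Y : ℝ → F, StronglyMeasurable Y ∧
      (∀ t, ‖Y t‖ ≤ 2 * Real.exp (2 * K * T) * (‖y₀‖ + C * T)) ∧
      ∀ t, Y t = y₀ + ∫ r in Iic t, f r (Y r) ∂(timeMeasure T) := by
  have : CompleteSpace F := FiniteDimensional.complete ℝ F
  have hC0 : 0 ≤ C := (norm_nonneg _).trans (h0 0)
  have hcont : ∀ r, Continuous (f r) := fun r =>
    (LipschitzWith.of_dist_le_mul (K := K.toNNReal) fun y z => by
      simpa [dist_eq_norm, hK] using hL r y z).continuous
  have hlin : ∀ r y, ‖f r y‖ ≤ K * ‖y‖ + C := fun r y => by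
    have h1 := hL r y 0
    rw [sub_zero] at h1
    calc ‖f r y‖ = ‖(f r y - f r 0) + f r 0‖ := by simp
      _ ≤ _ := (norm_add_le _ _).trans (add_le_add h1 (h0 r))
  have hwi : Integrable (expWeight K T) (timeMeasure T) :=
    ((continuous_expWeight K T).continuousOn.integrableOn_Icc (a := 0) (b := T)).mono_set
      Ioc_subset_Icc_self
  let P : ℕ → ℝ → F := fun k => Nat.rec (fun _ => y₀)
    (fun _ Z t => y₀ + ∫ r in Iic t, f r (Z r) ∂(timeMeasure T)) k
  have hP0 : P 0 = fun _ => y₀ := rfl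
  have hPs : ∀ k, P (k + 1) = fun t => y₀ + ∫ r in Iic t, f r (P k r) ∂(timeMeasure T) :=
    fun k => rfl
  set W := Real.exp (2 * K * T) with hW
  set m := (K * ‖y₀‖ + C) * T with hm
  have hm0 : 0 ≤ m := by positivity
  have hint : ∀ Z : ℝ → F, StronglyMeasurable Z → (∃ c, ∀ t, ‖Z t‖ ≤ c) →
      Integrable (fun r => f r (Z r)) (timeMeasure T) := by
    rintro Z hZ ⟨c, hc⟩
    refine Integrable.of_bound
      (stronglyMeasurable_caratheodory hf hcont hZ).aestronglyMeasurable (K * c + C)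
      (Eventually.of_forall fun r => (hlin r _).trans ?_)
    gcongr
    exact hc r
  have hPmeas : ∀ k, StronglyMeasurable (P k) ∧ ∃ c, ∀ t, ‖P k t‖ ≤ c := by
    intro k
    induction k with
    | zero => exact ⟨stronglyMeasurable_const, ‖y₀‖, fun _ => le_rfl⟩
    | succ k ih =>
      have hi := hint _ ih.1 ih.2
      refine ⟨?_, ‖y₀‖ + ∫ r, ‖f r (P k r)‖ ∂(timeMeasure T), fun t => ?_⟩
      · rw [hPs]
        exact (continuous_const.add (continuous_integral_Iic hi)).stronglyMeasurable
      · rw [hPs]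
        refine (norm_add_le _ _).trans ?_
        gcongr
        exact (norm_integral_le_integral_norm _).trans
          (integral_Iic_le_of_nonneg hi.norm (fun _ => norm_nonneg _) t)
  have hPi : ∀ k, Integrable (fun r => f r (P k r)) (timeMeasure T) := fun k =>
    hint _ (hPmeas k).1 (hPmeas k).2
  -- `m` bounds the first increment, and each further iteration gains the factor `1/2` in the
  -- weighted norm.
  have hstep : ∀ k t, ‖P (k + 1) t - P k t‖ ≤ m / 2 ^ k * expWeight K T t := by
    intro k
    induction k with
    | zero =>
      intro t
      rw [hPs, hP0]
      simp only [add_sub_cancel_left, pow_zero, div_one]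
      have h1 : ‖∫ r in Iic t, f r y₀ ∂(timeMeasure T)‖ ≤ m := by
        refine (norm_integral_le_of_norm_le (g := fun _ => K * ‖y₀‖ + C)
          (integrable_const _).integrableOn (Eventually.of_forall fun r => hlin r _)).trans ?_
        rw [hm, ← integral_timeMeasure_const_le hT]
        exact integral_Iic_le_of_nonneg (integrable_const _) (fun _ => by positivity) t
      nlinarith [one_le_expWeight hK T t]
    | succ k ih =>
      intro t
      have h1 : P (k + 1 + 1) t - P (k + 1) t
          = ∫ r in Iic t, (f r (P (k + 1) r) - f r (P k r)) ∂(timeMeasure T) := by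
        rw [integral_sub (hPi (k + 1)).integrableOn (hPi k).integrableOn, hPs (k + 1)]
        nth_rewrite 3 [hPs k]
        exact add_sub_add_left_eq_sub _ _ _
      rw [h1]
      refine (norm_integral_le_of_norm_le
        (g := fun r => K * (m / 2 ^ k) * expWeight K T r) (hwi.integrableOn.const_mul _)
        (Eventually.of_forall fun r => (hL r _ _).trans ?_)).trans ?_
      · rw [mul_assoc]
        gcongr
        exact ih r
      · rw [integral_const_mul]
        have h2 := integral_expWeight_le (T := T) hK t
        have h3 : 0 ≤ m / 2 ^ k := by positivity
        have h4 : m / 2 ^ (k + 1) = m / 2 ^ k / 2 := by rw [pow_succ, div_div]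
        rw [h4]
        nlinarith [mul_le_mul_of_nonneg_left h2 h3]
  have hgeo : ∀ t k, dist (P k t) (P (k + 1) t) ≤ 2 * (m * W) / 2 / 2 ^ k := by
    intro t k
    rw [dist_eq_norm, norm_sub_rev]
    refine (hstep k t).trans ?_
    calc m / 2 ^ k * expWeight K T t ≤ m / 2 ^ k * W :=
          mul_le_mul_of_nonneg_left (expWeight_le hK hT t) (by positivity)
      _ = _ := by ring
  have hlim : ∀ t, ∃ y, Tendsto (fun k => P k t) atTop (𝓝 y) := fun t =>
    cauchySeq_tendsto_of_complete (cauchySeq_of_le_geometric_two (hgeo t))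
  choose Y hY using hlim
  have hYm : StronglyMeasurable Y :=
    stronglyMeasurable_of_tendsto atTop (fun k => (hPmeas k).1) (tendsto_pi_nhds.2 hY)
  have hdist : ∀ t k, ‖P k t - Y t‖ ≤ 2 * (m * W) := fun t k => by
    rw [← dist_eq_norm]
    refine (dist_le_of_le_geometric_two_of_tendsto (hgeo t) (hY t) k).trans ?_
    exact div_le_self (by positivity) (one_le_pow₀ (by norm_num))
  have hYb : ∀ t, ‖Y t‖ ≤ ‖y₀‖ + 2 * (m * W) := fun t => by
    calc ‖Y t‖ = ‖y₀ - (P 0 t - Y t)‖ := by rw [hP0]; simp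
      _ ≤ _ := (norm_sub_le _ _).trans (by gcongr; exact hdist t 0)
  have hYeq : ∀ t, Y t = y₀ + ∫ r in Iic t, f r (Y r) ∂(timeMeasure T) := by
    intro t
    have h1 : Tendsto (fun k => P (k + 1) t) atTop (𝓝 (Y t)) :=
      (hY t).comp (tendsto_add_atTop_nat 1)
    refine tendsto_nhds_unique h1 ?_
    simp only [hPs]
    refine Tendsto.const_add _ (tendsto_integral_of_dominated_convergence
      (fun _ => K * (‖y₀‖ + 2 * (m * W) + 2 * (m * W)) + C)
      (fun k => (hPi k).integrableOn.aestronglyMeasurable) (integrable_const _)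
      (fun k => Eventually.of_forall fun r => (hlin r _).trans ?_)
      (Eventually.of_forall fun r => ((hcont r).tendsto _).comp (hY r)))
    gcongr
    calc ‖P k r‖ = ‖Y r + (P k r - Y r)‖ := by simp
      _ ≤ _ := (norm_add_le _ _).trans (add_le_add (hYb r) (hdist r k))
  -- The crude bound `hYb` from the iteration only serves to make Grönwall applicable, which then
  -- gives the stated bound.
  refine ⟨Y, hYm, fun t => ?_, hYeq⟩
  have := norm_le_of_eq_add_integral hK hT hYm hYb (integrable_const C) (fun _ => hC0)
    (fun r => hlin r (Y r)) hYeq t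
  rwa [integral_timeMeasure_const_le hT] at this

end Volterra

/-! ### Families of functions with uniformly bounded derivatives -/

/-- A family of `k` times continuously differentiable functions whose derivatives of order
`l, …, k` are bounded uniformly over the family. -/
structure IsCbFamily {θ E F : Type*} [NormedAddCommGroup E] [NormedSpace ℝ E]
    [NormedAddCommGroup F] [NormedSpace ℝ F] (l k : ℕ) (u : θ → E → F) : Prop where
  contDiff : ∀ i, ContDiff ℝ k (u i)
  bounded : ∀ j, l ≤ j → j ≤ k → ∃ C : ℝ, ∀ i x, ‖iteratedFDeriv ℝ j (u i) x‖ ≤ C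

namespace IsCbFamily

variable {θ E F G H : Type*} [NormedAddCommGroup E] [NormedSpace ℝ E]
    [NormedAddCommGroup F] [NormedSpace ℝ F] [NormedAddCommGroup G] [NormedSpace ℝ G]
    [NormedAddCommGroup H] [NormedSpace ℝ H]

lemma mono {l l' k k' : ℕ} {u : θ → E → F} (h : IsCbFamily l k u) (hl : l ≤ l') (hk : k' ≤ k) :
    IsCbFamily l' k' u where
  contDiff i := (h.contDiff i).of_le (by exact_mod_cast hk)
  bounded j h1 h2 := h.bounded j (hl.trans h1) (h2.trans hk)

lemma reindex {θ' : Type*} {l k : ℕ} {u : θ → E → F} (h : IsCbFamily l k u) (g : θ' → θ) :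
    IsCbFamily l k fun i => u (g i) where
  contDiff i := h.contDiff (g i)
  bounded j h1 h2 := (h.bounded j h1 h2).imp fun _ hC i => hC (g i)

/-- Finitely many bounds can be replaced by one. -/
lemma exists_bound {l k : ℕ} {u : θ → E → F} (h : IsCbFamily l k u) :
    ∃ C : ℝ, 1 ≤ C ∧ ∀ j, l ≤ j → j ≤ k → ∀ i x, ‖iteratedFDeriv ℝ j (u i) x‖ ≤ C := by
  have : ∀ j, ∃ C : ℝ, l ≤ j → j ≤ k → ∀ i x, ‖iteratedFDeriv ℝ j (u i) x‖ ≤ C := fun j => by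
    by_cases h1 : l ≤ j ∧ j ≤ k
    · obtain ⟨C, hC⟩ := h.bounded j h1.1 h1.2
      exact ⟨C, fun _ _ => hC⟩
    · exact ⟨0, fun h2 h3 => absurd ⟨h2, h3⟩ h1⟩
  choose C hC using this
  -- The summand `1` ensures `1 ≤ C`, which `comp` uses to replace a bound `D` by `D ^ m`.
  refine ⟨1 + ∑ j ∈ Finset.range (k + 1), |C j|, ?_, fun j h1 h2 i x => ?_⟩
  · have : 0 ≤ ∑ j ∈ Finset.range (k + 1), |C j| := Finset.sum_nonneg fun _ _ => abs_nonneg _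
    linarith
  · have := Finset.single_le_sum (f := fun j => |C j|) (fun _ _ => abs_nonneg _)
      (Finset.mem_range.2 (Nat.lt_succ_of_le h2))
    have h3 := (hC j h1 h2 i x).trans (le_abs_self _)
    exact h3.trans (this.trans (by linarith))

lemma exists_norm_le {k : ℕ} {u : θ → E → F} (h : IsCbFamily 0 k u) :
    ∃ C : ℝ, 0 ≤ C ∧ ∀ i x, ‖u i x‖ ≤ C := by
  obtain ⟨C, hC1, hC⟩ := h.exists_bound
  exact ⟨C, by linarith, fun i x => by simpa using hC 0 le_rfl (Nat.zero_le _) i x⟩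

lemma differentiable {l k : ℕ} {u : θ → E → F} (h : IsCbFamily l (k + 1) u) (i : θ) :
    Differentiable ℝ (u i) :=
  (h.contDiff i).differentiable (by simp)

lemma continuous {l k : ℕ} {u : θ → E → F} (h : IsCbFamily l k u) (i : θ) : Continuous (u i) :=
  (h.contDiff i).continuous

/-- Differentiation shifts the range of bounded orders from `1, …, k + 1` to `0, …, k`;
`of_hasFDerivAt` is the reverse passage, and together they drive the inductions on the order. -/
lemma fderiv {k : ℕ} {u : θ → E → F} (h : IsCbFamily 1 (k + 1) u) :
    IsCbFamily 0 k fun i => fderiv ℝ (u i) where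
  contDiff i := (h.contDiff i).fderiv_right (by norm_cast)
  bounded j _ h2 := by
    simp only [norm_iteratedFDeriv_fderiv]
    exact h.bounded (j + 1) (by omega) (by omega)

lemma of_hasFDerivAt {k : ℕ} {u : θ → E → F} {D : θ → E → E →L[ℝ] F}
    (hD : IsCbFamily 0 k D) (h : ∀ i x, HasFDerivAt (u i) (D i x) x) :
    IsCbFamily 1 (k + 1) u where
  contDiff i := by
    have h1 : _root_.fderiv ℝ (u i) = D i := funext fun x => (h i x).fderiv
    have := (contDiff_succ_iff_fderiv (𝕜 := ℝ) (n := k) (f := u i)).2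
      ⟨fun x => (h i x).differentiableAt, by simp, h1 ▸ hD.contDiff i⟩
    exact_mod_cast this
  bounded j h1 h2 := by
    obtain ⟨j, rfl⟩ : ∃ m, j = m + 1 := ⟨j - 1, by omega⟩
    have h3 : ∀ i, _root_.fderiv ℝ (u i) = D i := fun i => funext fun x => (h i x).fderiv
    simp only [← norm_iteratedFDeriv_fderiv, h3]
    exact hD.bounded j (Nat.zero_le _) (by omega)

lemma of_norm_le {k : ℕ} {u : θ → E → F} (h : IsCbFamily 1 k u) {C : ℝ} (hC : ∀ i x, ‖u i x‖ ≤ C) :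
    IsCbFamily 0 k u where
  contDiff := h.contDiff
  bounded j _ h2 := by
    rcases Nat.eq_zero_or_pos j with rfl | hj
    · exact ⟨C, fun i x => by simpa using hC i x⟩
    · exact h.bounded j hj h2

lemma of_continuous {u : θ → E → F} (h : ∀ i, Continuous (u i)) : IsCbFamily 1 0 u where
  contDiff i := contDiff_zero.2 (h i)
  bounded j h1 h2 := by omega

/-- By the Faà di Bruno bound, only derivatives of order at least `1` of the inner function enter,
so the inner function may be unbounded. -/
lemma comp {k : ℕ} {g : θ → F → G} {f : θ → E → F} (hg : IsCbFamily 0 k g)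
    (hf : IsCbFamily 1 k f) : IsCbFamily 0 k fun i x => g i (f i x) where
  contDiff i := (hg.contDiff i).comp (hf.contDiff i)
  bounded j _ h2 := by
    obtain ⟨C, hC1, hC⟩ := hg.exists_bound
    obtain ⟨D, hD1, hD⟩ := hf.exists_bound
    refine ⟨j.factorial * C * D ^ j, fun i x => ?_⟩
    refine norm_iteratedFDeriv_comp_le (hg.contDiff i) (hf.contDiff i) (by exact_mod_cast h2) x
      (fun m hm => hC m (Nat.zero_le _) (hm.trans h2) i _) fun m hm hm' => ?_
    exact (hD m hm (hm'.trans h2) i x).trans (le_self_pow₀ hD1 (by omega))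

lemma bilinear {k : ℕ} (B : F →L[ℝ] G →L[ℝ] H) {f : θ → E → F} {g : θ → E → G}
    (hf : IsCbFamily 0 k f) (hg : IsCbFamily 0 k g) :
    IsCbFamily 0 k fun i x => B (f i x) (g i x) where
  contDiff i := (B.contDiff.comp (hf.contDiff i)).clm_apply (hg.contDiff i)
  bounded j _ h2 := by
    obtain ⟨C, hC1, hC⟩ := hf.exists_bound
    obtain ⟨D, hD1, hD⟩ := hg.exists_bound
    refine ⟨‖B‖ * ∑ m ∈ Finset.range (j + 1), (j.choose m : ℝ) * C * D, fun i x => ?_⟩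
    refine (B.norm_iteratedFDeriv_le_of_bilinear (hf.contDiff i) (hg.contDiff i) x
      (by exact_mod_cast h2)).trans ?_
    gcongr with m hm
    · exact hC m (Nat.zero_le _) (by have := Finset.mem_range.1 hm; omega) i x
    · exact hD (j - m) (Nat.zero_le _) (by omega) i x

lemma clm_comp {k : ℕ} (B : F →L[ℝ] G) {f : θ → E → F} (hf : IsCbFamily 0 k f) :
    IsCbFamily 0 k fun i x => B (f i x) where
  contDiff i := B.contDiff.comp (hf.contDiff i)
  bounded j _ h2 := by
    obtain ⟨C, hC⟩ := hf.bounded j (Nat.zero_le _) h2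
    refine ⟨‖B‖ * C, fun i x => ?_⟩
    refine (B.norm_iteratedFDeriv_comp_left (hf.contDiff i).contDiffAt
      (by exact_mod_cast h2)).trans ?_
    gcongr
    exact hC i x

lemma add {l k : ℕ} {f g : θ → E → F} (hf : IsCbFamily l k f) (hg : IsCbFamily l k g) :
    IsCbFamily l k fun i x => f i x + g i x where
  contDiff i := (hf.contDiff i).add (hg.contDiff i)
  bounded j h1 h2 := by
    obtain ⟨C, hC⟩ := hf.bounded j h1 h2
    obtain ⟨D, hD⟩ := hg.bounded j h1 h2
    refine ⟨C + D, fun i x => ?_⟩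
    have : (fun x => f i x + g i x) = f i + g i := rfl
    rw [this, iteratedFDeriv_add_apply ((hf.contDiff i).contDiffAt.of_le (by exact_mod_cast h2))
      ((hg.contDiff i).contDiffAt.of_le (by exact_mod_cast h2))]
    exact (norm_add_le _ _).trans (add_le_add (hC i x) (hD i x))

/-- A uniform Lipschitz bound. -/
lemma exists_lipschitz {k : ℕ} {u : θ → E → F} (h : IsCbFamily 1 (k + 1) u) :
    ∃ C : ℝ, 0 ≤ C ∧ (∀ i x, ‖_root_.fderiv ℝ (u i) x‖ ≤ C) ∧
      ∀ i x y, ‖u i y - u i x‖ ≤ C * ‖y - x‖ := by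
  obtain ⟨C, hC0, hC⟩ := h.fderiv.exists_norm_le
  exact ⟨C, hC0, hC, fun i x y => convex_univ.norm_image_sub_le_of_norm_fderiv_le
    (fun z _ => h.differentiable i z) (fun z _ => hC i z) (mem_univ x) (mem_univ y)⟩

end IsCbFamily

/-! ### Measurability of derivatives -/

section Measurability

variable {α E F : Type*} [MeasurableSpace α] [NormedAddCommGroup E] [NormedSpace ℝ E]
  [FiniteDimensional ℝ E] [NormedAddCommGroup F] [NormedSpace ℝ F]

lemma stronglyMeasurable_clm_of_apply {A : α → E →L[ℝ] F}
    (h : ∀ v, StronglyMeasurable fun r => A r v) : StronglyMeasurable A := by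
  let b := Module.finBasis ℝ E
  let c : Fin (Module.finrank ℝ E) → E →L[ℝ] ℝ := fun i => (b.coord i).toContinuousLinearMap
  have h1 : A = fun r => ∑ i, ContinuousLinearMap.smulRightL ℝ E F (c i) (A r (b i)) := by
    funext r
    ext v
    have h2 : A r v = ∑ i, b.repr v i • A r (b i) := by
      conv_lhs => rw [← b.sum_repr v, map_sum]
      simp only [map_smul]
    simp [c, h2]
  rw [h1]
  refine Finset.stronglyMeasurable_fun_sum _ fun i _ => ?_
  exact (ContinuousLinearMap.smulRightL ℝ E F (c i)).continuous.comp_stronglyMeasurable (h _)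

/-- Each directional derivative is the limit of difference quotients with step `1/n`, and in finite
dimension finitely many directions determine the derivative. -/
lemma stronglyMeasurable_fderiv {u : α → E → F} (hu : ∀ x, StronglyMeasurable fun r => u r x)
    (hd : ∀ r, Differentiable ℝ (u r)) (x : E) :
    StronglyMeasurable fun r => fderiv ℝ (u r) x := by
  refine stronglyMeasurable_clm_of_apply fun v => ?_
  refine stronglyMeasurable_of_tendsto (f := fun (n : ℕ) r =>
    (n : ℝ) • (u r (x + (n : ℝ)⁻¹ • v) - u r x)) atTop
    (fun n => ((hu _).sub (hu _)).const_smul _) (tendsto_pi_nhds.2 fun r => ?_)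
  exact ((hd r x).hasFDerivAt.lim_real v).comp tendsto_natCast_atTop_atTop

end Measurability

/-! ### Smooth dependence on a parameter -/

section Parameter

variable {E F : Type*} [NormedAddCommGroup E] [NormedSpace ℝ E] [NormedAddCommGroup F]
  [NormedSpace ℝ F]

lemma MeasureTheory.StronglyMeasurable.clm_apply' {α : Type*} [MeasurableSpace α] {A : α → E →L[ℝ] F}
    {v : α → E} (hA : StronglyMeasurable A) (hv : StronglyMeasurable v) :
    StronglyMeasurable fun r => A r (v r) :=
  isBoundedBilinearMap_apply.continuous.comp_stronglyMeasurable (hA.prodMk hv)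

/-- Dominated convergence: the quotients tend to `0` at each time and are bounded by a constant. The
little-o need not be uniform in time. -/
lemma tendsto_integral_norm_div {E F : Type*} [NormedAddCommGroup E] [NormedAddCommGroup F]
    {T C : ℝ} {x : E} {rem : ℝ → E → F}
    (hm : ∀ y, StronglyMeasurable fun r => rem r y) (hC : ∀ r y, ‖rem r y‖ ≤ C * ‖y - x‖)
    (ho : ∀ r, (fun y => rem r y) =o[𝓝 x] fun y => y - x) :
    Tendsto (fun y => ∫ r, ‖rem r y‖ / ‖y - x‖ ∂(timeMeasure T)) (𝓝 x) (𝓝 0) := by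
  have h := tendsto_integral_filter_of_dominated_convergence (μ := timeMeasure T) (l := 𝓝 x)
    (F := fun y r => ‖rem r y‖ / ‖y - x‖) (f := fun _ => (0 : ℝ)) (fun _ => |C|)
    (Eventually.of_forall fun y => ((hm y).norm.div stronglyMeasurable_const).aestronglyMeasurable)
    (Eventually.of_forall fun y => Eventually.of_forall fun r => by
      rw [Real.norm_of_nonneg (by positivity)]
      refine div_le_of_le_mul₀ (norm_nonneg _) (abs_nonneg _) ((hC r y).trans ?_)
      gcongr
      exact le_abs_self C)
    (integrable_const _)
    (Eventually.of_forall fun r => (ho r).norm_norm.tendsto_div_nhds_zero)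
  simpa using h

/-- Differentiability of the solution of an integral equation with respect to a parameter: the
candidate derivative solves the linearised equation up to a remainder of order `o(y - x)`. -/
lemma hasFDerivAt_of_integral_eq {K T C : ℝ} (hK : 0 ≤ K) (hT : 0 ≤ T) {x : E}
    {Y G : ℝ → E → F} {y₀ : E → F} {D A : ℝ → E →L[ℝ] F} {D₀ : E →L[ℝ] F} {M : ℝ → F →L[ℝ] F}
    [CompleteSpace F]
    (hYm : ∀ y, StronglyMeasurable fun r => Y r y) (hYb : ∀ y, ∃ c, ∀ r, ‖Y r y‖ ≤ c)
    (hDm : StronglyMeasurable D) (hDb : ∃ c, ∀ r, ‖D r‖ ≤ c) (hM : ∀ r, ‖M r‖ ≤ K)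
    (hG : ∀ y, Integrable (fun r => G r y) (timeMeasure T))
    (hY : ∀ t y, Y t y = y₀ y + ∫ r in Iic t, G r y ∂(timeMeasure T))
    (hA : Integrable (fun r => (M r).comp (D r) + A r) (timeMeasure T))
    (hD : ∀ t, D t = D₀ + ∫ r in Iic t, ((M r).comp (D r) + A r) ∂(timeMeasure T))
    (hy₀ : ∀ y, y₀ y - y₀ x = D₀ (y - x)) {rem : ℝ → E → F}
    (hrem : ∀ r y, G r y - G r x = M r (Y r y - Y r x) + A r (y - x) + rem r y)
    (hremm : ∀ y, StronglyMeasurable fun r => rem r y)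
    (hremC : ∀ r y, ‖rem r y‖ ≤ C * ‖y - x‖)
    (hremo : ∀ r, (fun y => rem r y) =o[𝓝 x] fun y => y - x) (t : ℝ) :
    HasFDerivAt (Y t) (D t) x := by
  have hremi : ∀ y, Integrable (fun r => ‖rem r y‖) (timeMeasure T) := fun y =>
    (Integrable.of_bound (hremm y).aestronglyMeasurable _ (Eventually.of_forall fun r =>
      hremC r y)).norm
  -- The linearisation error solves the equation with coefficient `M`, source `rem` and zero initial
  -- value, so Grönwall bounds it by the integral of `rem`.
  have key : ∀ y, ‖Y t y - Y t x - D t (y - x)‖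
      ≤ 2 * Real.exp (2 * K * T) * ∫ r, ‖rem r y‖ ∂(timeMeasure T) := by
    intro y
    obtain ⟨c₁, hc₁⟩ := hYb y
    obtain ⟨c₂, hc₂⟩ := hYb x
    obtain ⟨c₃, hc₃⟩ := hDb
    have := norm_le_of_eq_add_integral (u := fun t => Y t y - Y t x - D t (y - x)) (u₀ := (0 : F))
      (A := fun r => M r (Y r y - Y r x - D r (y - x)) + rem r y)
      (C := c₁ + c₂ + c₃ * ‖y - x‖) hK hT
      (((hYm y).sub (hYm x)).sub (hDm.clm_apply' stronglyMeasurable_const))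
      (fun t => (norm_sub_le _ _).trans (add_le_add ((norm_sub_le _ _).trans
        (add_le_add (hc₁ t) (hc₂ t))) (((D t).le_opNorm _).trans (by gcongr; exact hc₃ t))))
      (hremi y) (fun _ => norm_nonneg _)
      (fun r => (norm_add_le _ _).trans (by
        gcongr
        exact ((M r).le_opNorm _).trans (by gcongr; exact hM r)))
      (fun t => by
        have h1 : (∫ r in Iic t, ((M r).comp (D r) + A r) ∂(timeMeasure T)) (y - x)
            = ∫ r in Iic t, ((M r).comp (D r) + A r) (y - x) ∂(timeMeasure T) :=
          ContinuousLinearMap.integral_apply hA.integrableOn _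
        have h2 := hA.integrableOn (s := Iic t) |>.apply_continuousLinearMap (y - x)
        have h3 : Integrable (fun r => G r y - G r x) ((timeMeasure T).restrict (Iic t)) :=
          (hG y).integrableOn.sub (hG x).integrableOn
        rw [hY t y, hY t x, hD t, add_sub_add_comm, hy₀, add_apply, h1,
          ← integral_sub (hG y).integrableOn (hG x).integrableOn, add_sub_add_left_eq_sub,
          ← integral_sub h3 h2, zero_add]
        congr 1
        funext r
        rw [hrem r y]
        simp only [add_apply, ContinuousLinearMap.comp_apply, map_sub]
        abel) t
    simpa using this
  have hq := (tendsto_integral_norm_div (T := T) hremm hremC hremo).const_mul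
    (2 * Real.exp (2 * K * T))
  rw [mul_zero] at hq
  refine HasFDerivAt.of_isLittleO (Asymptotics.isLittleO_iff.2 fun c hc => ?_)
  filter_upwards [hq.eventually_le_const hc] with y hy
  refine (key y).trans ?_
  rcases eq_or_ne (‖y - x‖) 0 with h0 | h0
  · have : ∀ r, ‖rem r y‖ = 0 := fun r =>
      le_antisymm ((hremC r y).trans_eq (by rw [h0, mul_zero])) (norm_nonneg _)
    simp [this, h0]
  · rw [integral_div, ← mul_div_assoc, div_le_iff₀ (by positivity)] at hy
    exact hy

variable {ι : Type*}

/-- The solution of a linear integral equation inherits the regularity of the coefficients: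
continuity. -/
lemma continuous_of_linear {T : ℝ} (hT : 0 ≤ T) {M : ι → ℝ → E → F →L[ℝ] F}
    {g J : ι → ℝ → E → F} {J₀ : F} (hM : IsCbFamily 0 0 fun p : ι × ℝ => M p.1 p.2)
    (hg : IsCbFamily 0 0 fun p : ι × ℝ => g p.1 p.2)
    (hMm : ∀ i x, StronglyMeasurable fun r => M i r x)
    (hgm : ∀ i x, StronglyMeasurable fun r => g i r x)
    (hJm : ∀ i x, StronglyMeasurable fun r => J i r x) {c : ℝ} (hJb : ∀ i r x, ‖J i r x‖ ≤ c)
    (hJ : ∀ i t x, J i t x = J₀ + ∫ r in Iic t, (M i r x (J i r x) + g i r x) ∂(timeMeasure T))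
    (i : ι) (t : ℝ) : Continuous (J i t) := by
  obtain ⟨K, hK, hMK⟩ := hM.exists_norm_le
  obtain ⟨C, hC, hgC⟩ := hg.exists_norm_le
  have hGi : ∀ y, Integrable (fun r => M i r y (J i r y) + g i r y) (timeMeasure T) := fun y =>
    Integrable.of_bound (((hMm i y).clm_apply' (hJm i y)).add (hgm i y)).aestronglyMeasurable
      (K * c + C) (Eventually.of_forall fun r => (norm_add_le _ _).trans (by
        gcongr
        · exact ((M i r y).le_opNorm _).trans
            (mul_le_mul (hMK (i, r) y) (hJb i r y) (norm_nonneg _) hK)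
        · exact hgC (i, r) y))
  refine continuous_iff_continuousAt.2 fun x => ?_
  -- With the coefficients frozen at `x`, the difference `J y - J x` solves a linear equation whose
  -- source is `e y`.
  let e : E → ℝ → F := fun y r => (M i r y - M i r x) (J i r y) + (g i r y - g i r x)
  have hem : ∀ y, StronglyMeasurable (e y) := fun y =>
    (((hMm i y).sub (hMm i x)).clm_apply' (hJm i y)).add ((hgm i y).sub (hgm i x))
  have hec : ∀ y r, ‖e y r‖ ≤ ‖M i r y - M i r x‖ * c + ‖g i r y - g i r x‖ := fun y r =>
    (norm_add_le _ _).trans (by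
      gcongr
      exact (ContinuousLinearMap.le_opNorm _ _).trans (by gcongr; exact hJb i r y))
  have hc0 : 0 ≤ c := (norm_nonneg _).trans (hJb i 0 x)
  have heb : ∀ y r, ‖e y r‖ ≤ (K + K) * c + (C + C) := fun y r => (hec y r).trans (by
    gcongr
    · exact (norm_sub_le _ _).trans (add_le_add (hMK (i, r) y) (hMK (i, r) x))
    · exact (norm_sub_le _ _).trans (add_le_add (hgC (i, r) y) (hgC (i, r) x)))
  have hei : ∀ y, Integrable (fun r => ‖e y r‖) (timeMeasure T) := fun y =>
    (Integrable.of_bound (hem y).aestronglyMeasurable _ (Eventually.of_forall (heb y))).norm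
  have key : ∀ y, ‖J i t y - J i t x‖
      ≤ 2 * Real.exp (2 * K * T) * ∫ r, ‖e y r‖ ∂(timeMeasure T) := by
    intro y
    have := norm_le_of_eq_add_integral (u := fun t => J i t y - J i t x) (u₀ := (0 : F))
      (A := fun r => M i r x (J i r y - J i r x) + e y r)
      (C := c + c) hK hT ((hJm i y).sub (hJm i x))
      (fun t => (norm_sub_le _ _).trans (add_le_add (hJb i t y) (hJb i t x)))
      (hei y) (fun _ => norm_nonneg _)
      (fun r => (norm_add_le _ _).trans (by
        gcongr
        exact ((M i r x).le_opNorm _).trans (by gcongr; exact hMK (i, r) x)))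
      (fun t => by
        rw [hJ i t y, hJ i t x, add_sub_add_left_eq_sub,
          ← integral_sub (hGi y).integrableOn (hGi x).integrableOn, zero_add]
        congr 1
        funext r
        simp only [e, sub_apply, map_sub]
        abel) t
    simpa using this
  have hlim : Tendsto (fun y => ∫ r, ‖e y r‖ ∂(timeMeasure T)) (𝓝 x) (𝓝 0) := by
    have h := tendsto_integral_filter_of_dominated_convergence (μ := timeMeasure T) (l := 𝓝 x)
      (F := fun y r => ‖e y r‖) (f := fun _ => (0 : ℝ)) (fun _ => (K + K) * c + (C + C))
      (Eventually.of_forall fun y => (hem y).norm.aestronglyMeasurable)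
      (Eventually.of_forall fun y => Eventually.of_forall fun r => by
        rw [norm_norm]; exact heb y r)
      (integrable_const _)
      (Eventually.of_forall fun r => by
        refine squeeze_zero (fun _ => norm_nonneg _) (fun y => hec y r) ?_
        have h1 : Continuous fun y => ‖M i r y - M i r x‖ * c + ‖g i r y - g i r x‖ := by
          have := hM.continuous (i, r)
          have := hg.continuous (i, r)
          fun_prop
        simpa using h1.tendsto x)
    simpa using h
  have := hlim.const_mul (2 * Real.exp (2 * K * T))
  rw [mul_zero] at this
  exact tendsto_iff_norm_sub_tendsto_zero.2 (squeeze_zero (fun _ => norm_nonneg _) key this)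

end Parameter

-- Regularity for linear integral equations.

universe u

/-- The composition `(A, v) ↦ (h ↦ A h v)` as a bilinear map. -/
noncomputable def flipEval (E F G : Type*) [NormedAddCommGroup E] [NormedSpace ℝ E]
    [NormedAddCommGroup F] [NormedSpace ℝ F] [NormedAddCommGroup G] [NormedSpace ℝ G] :
    (E →L[ℝ] F →L[ℝ] G) →L[ℝ] F →L[ℝ] E →L[ℝ] G :=
  (ContinuousLinearMap.flipₗᵢ ℝ E F G).toContinuousLinearEquiv.toContinuousLinearMap

@[simp] lemma flipEval_apply {E F G : Type*} [NormedAddCommGroup E] [NormedSpace ℝ E]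
    [NormedAddCommGroup F] [NormedSpace ℝ F] [NormedAddCommGroup G] [NormedSpace ℝ G]
    (A : E →L[ℝ] F →L[ℝ] G) (v : F) (h : E) : flipEval E F G A v h = A h v := rfl

section Linear

variable {ι : Type*} {E : Type u} [NormedAddCommGroup E] [NormedSpace ℝ E] [FiniteDimensional ℝ E]

/-- The solution of a linear integral equation inherits the regularity of the coefficients. -/
lemma isCbFamily_of_linear {T : ℝ} (hT : 0 ≤ T) (k : ℕ) :
    ∀ {F : Type u} [NormedAddCommGroup F] [NormedSpace ℝ F] [FiniteDimensional ℝ F]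
      {M : ι → ℝ → E → F →L[ℝ] F} {g J : ι → ℝ → E → F} {J₀ : F},
      (IsCbFamily 0 k fun p : ι × ℝ => M p.1 p.2) →
      (IsCbFamily 0 k fun p : ι × ℝ => g p.1 p.2) →
      (∀ i x, StronglyMeasurable fun r => M i r x) →
      (∀ i x, StronglyMeasurable fun r => g i r x) →
      (∀ i x, StronglyMeasurable fun r => J i r x) → (∃ c, ∀ i r x, ‖J i r x‖ ≤ c) →
      (∀ i t x, J i t x = J₀ + ∫ r in Iic t, (M i r x (J i r x) + g i r x) ∂(timeMeasure T)) →
      IsCbFamily 0 k fun p : ι × ℝ => J p.1 p.2 := by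
  -- `F` stays quantified because the derivative of `J` solves an equation of the same type with
  -- values in `E →L[ℝ] F`; a common universe for `E` and `F` keeps that space admissible. The
  -- induction hypothesis is used twice: for `J`, so that the source `S` has order `k`, and then for
  -- the derivative `D`.
  induction k with
  | zero =>
    intro F _ _ _ M g J J₀ hM hg hMm hgm hJm hJb hJ
    obtain ⟨c, hc⟩ := hJb
    exact (IsCbFamily.of_continuous (u := fun p : ι × ℝ => J p.1 p.2) fun p =>
      continuous_of_linear hT hM hg hMm hgm hJm hc hJ p.1 p.2).of_norm_le fun p x => hc p.1 p.2 x
  | succ k ih =>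
    intro F _ _ _ M g J J₀ hM hg hMm hgm hJm hJb hJ
    have : CompleteSpace F := FiniteDimensional.complete ℝ F
    obtain ⟨c, hc⟩ := hJb
    have hJk := ih (hM.mono le_rfl k.le_succ) (hg.mono le_rfl k.le_succ) hMm hgm hJm ⟨c, hc⟩ hJ
    have hM' := hM.mono zero_le_one le_rfl
    have hg' := hg.mono zero_le_one le_rfl
    obtain ⟨K, hK, hMK⟩ := hM.exists_norm_le
    obtain ⟨C, hC, hgC⟩ := hg.exists_norm_le
    obtain ⟨CM, hCM, hDM, hLM⟩ := hM'.exists_lipschitz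
    obtain ⟨Cg, hCg, hDg, hLg⟩ := hg'.exists_lipschitz
    -- Formal differentiation of `M J + g` gives `M D + S`; `S` collects the terms in which a
    -- coefficient is differentiated.
    let S : ι → ℝ → E → E →L[ℝ] F := fun i r x =>
      flipEval E F F (fderiv ℝ (M i r) x) (J i r x) + fderiv ℝ (g i r) x
    have hS : IsCbFamily 0 k fun p : ι × ℝ => S p.1 p.2 := by
      have h1 := IsCbFamily.bilinear (θ := ι × ℝ) (flipEval E F F)
        (f := fun p => fderiv ℝ (M p.1 p.2)) (g := fun p => J p.1 p.2) hM'.fderiv hJk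
      exact IsCbFamily.add (θ := ι × ℝ)
        (f := fun p x => flipEval E F F (fderiv ℝ (M p.1 p.2) x) (J p.1 p.2 x))
        (g := fun p => fderiv ℝ (g p.1 p.2)) h1 hg'.fderiv
    have hDMm : ∀ i x, StronglyMeasurable fun r => fderiv ℝ (M i r) x := fun i =>
      stronglyMeasurable_fderiv (hMm i) fun r => hM'.differentiable (i, r)
    have hDgm : ∀ i x, StronglyMeasurable fun r => fderiv ℝ (g i r) x := fun i =>
      stronglyMeasurable_fderiv (hgm i) fun r => hg'.differentiable (i, r)
    have hSm : ∀ i x, StronglyMeasurable fun r => S i r x := fun i x => by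
      have h1 : StronglyMeasurable fun r => flipEval E F F (fderiv ℝ (M i r) x) :=
        (flipEval E F F).continuous.comp_stronglyMeasurable (hDMm i x)
      exact (h1.clm_apply' (hJm i x)).add (hDgm i x)
    obtain ⟨CS, hCS, hSC⟩ := hS.exists_norm_le
    let M' : ι → ℝ → E → (E →L[ℝ] F) →L[ℝ] (E →L[ℝ] F) := fun i r x =>
      ContinuousLinearMap.compL ℝ E F F (M i r x)
    have hM'm : ∀ i x, StronglyMeasurable fun r => M' i r x := fun i x =>
      (ContinuousLinearMap.compL ℝ E F F).continuous.comp_stronglyMeasurable (hMm i x)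
    have hMlip : ∀ i r x d, ‖M' i r x d‖ ≤ K * ‖d‖ := fun i r x d =>
      (ContinuousLinearMap.opNorm_comp_le _ _).trans (by gcongr; exact hMK (i, r) x)
    have hex : ∀ i x, ∃ D : ℝ → E →L[ℝ] F, StronglyMeasurable D ∧
        (∀ t, ‖D t‖ ≤ 2 * Real.exp (2 * K * T) * (‖(0 : E →L[ℝ] F)‖ + CS * T)) ∧
        ∀ t, D t = 0 + ∫ r in Iic t, (M' i r x (D r) + S i r x) ∂(timeMeasure T) := fun i x =>
      exists_eq_add_integral (f := fun r d => M' i r x d + S i r x) hK hT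
        (fun y => ((hM'm i x).clm_apply' stronglyMeasurable_const).add (hSm i x))
        (fun r y z => by rw [add_sub_add_right_eq_sub, ← map_sub]; exact hMlip i r x _)
        (fun r => by rw [map_zero, zero_add]; exact hSC (i, r) x) 0
    choose D hDm hDb hD using hex
    have hM'k : IsCbFamily 0 k fun p : ι × ℝ => M' p.1 p.2 := by
      have h1 : IsCbFamily 0 k fun p : ι × ℝ => M p.1 p.2 := hM.mono le_rfl k.le_succ
      exact h1.clm_comp (G := (E →L[ℝ] F) →L[ℝ] E →L[ℝ] F)
        (ContinuousLinearMap.compL ℝ E F F)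
    have hDk : IsCbFamily 0 k fun p : ι × ℝ => fun x => D p.1 x p.2 :=
      ih (F := E →L[ℝ] F) (M := M') (g := S) (J := fun i r x => D i x r) (J₀ := 0)
        hM'k hS
        hM'm hSm hDm ⟨_, fun i r x => hDb i x r⟩ fun i t x => hD i x t
    refine (IsCbFamily.of_hasFDerivAt hDk fun p x => ?_).of_norm_le fun p x => hc p.1 p.2 x
    obtain ⟨i, t⟩ := p
    have hJi : ∀ y, Integrable (fun r => M i r y (J i r y) + g i r y) (timeMeasure T) := fun y =>
      Integrable.of_bound (((hMm i y).clm_apply' (hJm i y)).add (hgm i y)).aestronglyMeasurable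
        (K * c + C) (Eventually.of_forall fun r => (norm_add_le _ _).trans (by
          gcongr
          · exact ((M i r y).le_opNorm _).trans
              (mul_le_mul (hMK (i, r) y) (hc i r y) (norm_nonneg _) hK)
          · exact hgC (i, r) y))
    have hDi : Integrable (fun r => M' i r x (D i x r) + S i r x) (timeMeasure T) :=
      Integrable.of_bound (((hM'm i x).clm_apply' (hDm i x)).add (hSm i x)).aestronglyMeasurable
        (K * (2 * Real.exp (2 * K * T) * (‖(0 : E →L[ℝ] F)‖ + CS * T)) + CS)
        (Eventually.of_forall fun r => (norm_add_le _ _).trans (by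
          gcongr
          · exact (hMlip i r x _).trans (by gcongr; exact hDb i x r)
          · exact hSC (i, r) x))
    have hc0 : 0 ≤ c := (norm_nonneg _).trans (hc i 0 x)
    refine hasFDerivAt_of_integral_eq (C := (CM + CM) * c + CM * (c + c) + (Cg + Cg)) hK hT
      (Y := J i) (G := fun r y => M i r y (J i r y) + g i r y) (y₀ := fun _ => J₀) (D := D i x)
      (A := fun r => S i r x) (D₀ := 0) (M := fun r => M i r x)
      (rem := fun r y => (M i r y - M i r x - fderiv ℝ (M i r) x (y - x)) (J i r y)
        + fderiv ℝ (M i r) x (y - x) (J i r y - J i r x)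
        + (g i r y - g i r x - fderiv ℝ (g i r) x (y - x)))
      (hJm i) (fun y => ⟨c, fun r => hc i r y⟩) (hDm i x) ⟨_, hDb i x⟩ (fun r => hMK (i, r) x)
      hJi (hJ i) hDi (hD i x) (fun y => by simp) (fun r y => ?_) (fun y => ?_) (fun r y => ?_)
      (fun r => ?_) t
    · simp only [S, flipEval_apply, sub_apply, add_apply, map_sub]
      abel
    · have h1 := (hDMm i x).clm_apply' (stronglyMeasurable_const (b := y - x))
      have h2 := (hDgm i x).clm_apply' (stronglyMeasurable_const (b := y - x))
      exact (((((hMm i y).sub (hMm i x)).sub h1).clm_apply' (hJm i y)).add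
        (h1.clm_apply' ((hJm i y).sub (hJm i x)))).add (((hgm i y).sub (hgm i x)).sub h2)
    · have h1 : ‖fderiv ℝ (M i r) x (y - x)‖ ≤ CM * ‖y - x‖ :=
        (ContinuousLinearMap.le_opNorm _ _).trans (by gcongr; exact hDM (i, r) x)
      have h2 : ‖fderiv ℝ (g i r) x (y - x)‖ ≤ Cg * ‖y - x‖ :=
        (ContinuousLinearMap.le_opNorm _ _).trans (by gcongr; exact hDg (i, r) x)
      calc _ ≤ (CM * ‖y - x‖ + CM * ‖y - x‖) * c + CM * ‖y - x‖ * (c + c)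
            + (Cg * ‖y - x‖ + Cg * ‖y - x‖) := by
            refine (norm_add₃_le).trans ?_
            gcongr
            · refine (ContinuousLinearMap.le_opNorm _ _).trans ?_
              gcongr
              · exact (norm_sub_le _ _).trans (add_le_add (hLM (i, r) x y) h1)
              · exact hc i r y
            · refine (ContinuousLinearMap.le_opNorm _ _).trans ?_
              gcongr
              exact (norm_sub_le _ _).trans (add_le_add (hc i r y) (hc i r x))
            · exact (norm_sub_le _ _).trans (add_le_add (hLg (i, r) x y) h2)
        _ = _ := by ring
    · have h1 : (fun y => M i r y - M i r x - fderiv ℝ (M i r) x (y - x)) =o[𝓝 x]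
          fun y => y - x := (hM'.differentiable (i, r) x).hasFDerivAt.isLittleO
      have h2 : (fun y => g i r y - g i r x - fderiv ℝ (g i r) x (y - x)) =o[𝓝 x]
          fun y => y - x := (hg'.differentiable (i, r) x).hasFDerivAt.isLittleO
      have h3 : (fun y => J i r y - J i r x) =o[𝓝 x] fun _ => (1 : ℝ) := by
        rw [Asymptotics.isLittleO_one_iff]
        have := (hJk.continuous (i, r)).tendsto x
        simpa using this.sub_const (J i r x)
      refine (Asymptotics.IsLittleO.add ?_ ?_).add h2
      · refine Asymptotics.IsBigO.trans_isLittleO (g := fun y =>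
          M i r y - M i r x - fderiv ℝ (M i r) x (y - x)) ?_ h1
        refine Asymptotics.IsBigO.of_bound c (Eventually.of_forall fun y => ?_)
        refine (ContinuousLinearMap.le_opNorm _ _).trans ?_
        rw [mul_comm]
        gcongr
        exact hc i r y
      -- The cross term is `O(y - x)` times the increment of `J`, which is `o(1)` by the continuity
      -- in `hJk`.
      · have h4 : (fun y => fderiv ℝ (M i r) x (y - x) (J i r y - J i r x)) =O[𝓝 x]
            fun y => ‖y - x‖ * ‖J i r y - J i r x‖ := by
          refine Asymptotics.IsBigO.of_bound CM (Eventually.of_forall fun y => ?_)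
          refine (ContinuousLinearMap.le_opNorm _ _).trans ?_
          rw [norm_mul, norm_norm, norm_norm, ← mul_assoc]
          gcongr
          exact (ContinuousLinearMap.le_opNorm _ _).trans (by gcongr; exact hDM (i, r) x)
        refine h4.trans_isLittleO ?_
        have h5 := (Asymptotics.isBigO_refl (fun y : E => ‖y - x‖) (𝓝 x)).mul_isLittleO h3.norm_left
        simp only [mul_one] at h5
        exact h5.of_norm_right

end Linear

/-! ### Smoothness of nonlinear flows. -/

section Flow

variable {ι : Type*} {E : Type u} [NormedAddCommGroup E] [NormedSpace ℝ E] [FiniteDimensional ℝ E]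

/-- The flow of an integral equation whose right-hand side is smooth in space and measurable in
time is smooth in the initial value, with uniformly bounded derivatives. -/
lemma exists_flow {T : ℝ} (hT : 0 ≤ T) {n : ℕ} {f : ι → ℝ → E → E}
    (hf : IsCbFamily 1 (n + 1) fun p : ι × ℝ => f p.1 p.2) (hf0 : ∀ i r, f i r 0 = 0)
    (hfm : ∀ i x, StronglyMeasurable fun r => f i r x) :
    ∃ Y : ι → ℝ → E → E, (IsCbFamily 1 (n + 1) fun p : ι × ℝ => Y p.1 p.2) ∧
      (∀ i x, StronglyMeasurable fun r => Y i r x) ∧ (∀ i x, ∃ c, ∀ r, ‖Y i r x‖ ≤ c) ∧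
      ∀ i t x, Y i t x = x + ∫ r in Iic t, f i r (Y i r x) ∂(timeMeasure T) := by
  have : CompleteSpace E := FiniteDimensional.complete ℝ E
  obtain ⟨K, hK, hDf, hLf⟩ := hf.exists_lipschitz
  -- As `f` vanishes at `0`, the constant `C` is `0` and no bound on `f` itself is needed.
  have hex : ∀ i x, _ := fun i x => exists_eq_add_integral (f := f i) (C := 0) hK hT (hfm i)
    (fun r y z => hLf (i, r) z y) (fun r => by simp [hf0]) x
  choose Y hYm hYb hY using hex
  have hcomp : ∀ i x, StronglyMeasurable fun r => f i r (Y i x r) := fun i x =>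
    stronglyMeasurable_caratheodory (hfm i) (fun r => hf.continuous (i, r)) (hYm i x)
  have hYi : ∀ i x, Integrable (fun r => f i r (Y i x r)) (timeMeasure T) := fun i x =>
    Integrable.of_bound (hcomp i x).aestronglyMeasurable
      (K * (2 * Real.exp (2 * K * T) * (‖x‖ + 0 * T))) (Eventually.of_forall fun r => by
        have := hLf (i, r) 0 (Y i x r)
        simp only [hf0, sub_zero] at this
        exact this.trans (by gcongr; exact hYb i x r))
  set W := 2 * Real.exp (2 * K * T) with hW
  have hW0 : 0 ≤ W := by positivity
  have hYL : ∀ i t x y, ‖Y i y t - Y i x t‖ ≤ W * ‖y - x‖ := by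
    intro i t x y
    have := norm_le_of_eq_add_integral (u := fun t => Y i y t - Y i x t) (u₀ := y - x)
      (A := fun r => f i r (Y i y r) - f i r (Y i x r)) (e := fun _ => 0)
      (T := T) hK hT ((hYm i y).sub (hYm i x))
      (fun t => (norm_sub_le _ _).trans (add_le_add (hYb i y t) (hYb i x t)))
      (integrable_const _) (fun _ => le_rfl)
      (fun r => by rw [add_zero]; exact hLf (i, r) _ _)
      (fun t => by
        rw [hY i y t, hY i x t, add_sub_add_comm,
          ← integral_sub (hYi i y).integrableOn (hYi i x).integrableOn]) t
    simpa using this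
  let M : ι → ℝ → E → E →L[ℝ] E := fun i r x => fderiv ℝ (f i r) (Y i x r)
  have hMm : ∀ i x, StronglyMeasurable fun r => M i r x := fun i x =>
    stronglyMeasurable_caratheodory
      (stronglyMeasurable_fderiv (hfm i) fun r => hf.differentiable (i, r))
      (fun r => hf.fderiv.continuous (i, r)) (hYm i x)
  have hMK : ∀ i r x, ‖M i r x‖ ≤ K := fun i r x => hDf (i, r) _
  let M' : ι → ℝ → E → (E →L[ℝ] E) →L[ℝ] (E →L[ℝ] E) := fun i r x =>
    ContinuousLinearMap.compL ℝ E E E (M i r x)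
  have hM'm : ∀ i x, StronglyMeasurable fun r => M' i r x := fun i x =>
    (ContinuousLinearMap.compL ℝ E E E).continuous.comp_stronglyMeasurable (hMm i x)
  have hMlip : ∀ i r x d, ‖M' i r x d‖ ≤ K * ‖d‖ := fun i r x d =>
    (ContinuousLinearMap.opNorm_comp_le _ _).trans (by gcongr; exact hMK i r x)
  have hexD : ∀ i x, ∃ D : ℝ → E →L[ℝ] E, StronglyMeasurable D ∧
      (∀ t, ‖D t‖ ≤ W * (‖ContinuousLinearMap.id ℝ E‖ + 0 * T)) ∧
      ∀ t, D t = ContinuousLinearMap.id ℝ E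
        + ∫ r in Iic t, (M' i r x (D r) + 0) ∂(timeMeasure T) := fun i x =>
    exists_eq_add_integral (f := fun r d => M' i r x d + 0) hK hT
      (fun y => ((hM'm i x).clm_apply' stronglyMeasurable_const).add stronglyMeasurable_const)
      (fun r y z => by rw [add_sub_add_right_eq_sub, ← map_sub]; exact hMlip i r x _)
      (fun r => by simp) _
  choose D hDm hDb hD using hexD
  have hder : ∀ i t x, HasFDerivAt (fun x => Y i x t) (D i x t) x := by
    intro i t x
    have hDi : Integrable (fun r => M' i r x (D i x r) + 0) (timeMeasure T) :=
      Integrable.of_bound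
        (((hM'm i x).clm_apply' (hDm i x)).add stronglyMeasurable_const).aestronglyMeasurable
        (K * (W * (‖ContinuousLinearMap.id ℝ E‖ + 0 * T)))
        (Eventually.of_forall fun r => by
          rw [add_zero]
          exact (hMlip i r x _).trans (by gcongr; exact hDb i x r))
    refine hasFDerivAt_of_integral_eq (C := K * W + K * W) hK hT
      (Y := fun t x => Y i x t) (G := fun r y => f i r (Y i y r)) (y₀ := fun y => y) (D := D i x)
      (A := fun r => 0) (D₀ := ContinuousLinearMap.id ℝ E) (M := fun r => M i r x)
      (rem := fun r y => f i r (Y i y r) - f i r (Y i x r) - M i r x (Y i y r - Y i x r))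
      (hYm i) (fun y => ⟨_, hYb i y⟩) (hDm i x) ⟨_, hDb i x⟩ (fun r => hMK i r x)
      (hYi i) (fun t y => hY i y t) hDi (hD i x) (fun y => by simp) (fun r y => by simp)
      (fun y => ((hcomp i y).sub (hcomp i x)).sub ((hMm i x).clm_apply' ((hYm i y).sub (hYm i x))))
      (fun r y => ?_) (fun r => ?_) t
    · rw [add_mul, mul_assoc]
      refine (norm_sub_le _ _).trans (add_le_add ?_ ?_)
      · exact (hLf (i, r) _ _).trans (by gcongr; exact hYL i r x y)
      · refine (ContinuousLinearMap.le_opNorm _ _).trans ?_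
        exact mul_le_mul (hMK i r x) (hYL i r x y) (norm_nonneg _) hK
    · have h1 : Tendsto (fun y => Y i y r) (𝓝 x) (𝓝 (Y i x r)) := by
        refine tendsto_iff_norm_sub_tendsto_zero.2
          (squeeze_zero (fun _ => norm_nonneg _) (hYL i r x) ?_)
        have : Continuous fun y => W * ‖y - x‖ := by fun_prop
        simpa using this.tendsto x
      have h2 := ((hf.differentiable (i, r) (Y i x r)).hasFDerivAt.isLittleO).comp_tendsto h1
      refine h2.trans_isBigO (Asymptotics.IsBigO.of_bound W (Eventually.of_forall fun y => ?_))
      exact hYL i r x y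
  -- Bootstrap: if `Y` has order `k`, so does `M = Df(Y)`, hence also `D`, the solution of the
  -- linearised equation, and therefore `Y` has order `k + 1`.
  have hind : ∀ k ≤ n + 1, IsCbFamily 1 k fun p : ι × ℝ => fun x => Y p.1 x p.2 := by
    intro k
    induction k with
    | zero =>
      exact fun _ => IsCbFamily.of_continuous fun p => continuous_iff_continuousAt.2 fun x =>
        (hder p.1 p.2 x).continuousAt
    | succ k ih =>
      intro hk
      have hYk := ih (by omega)
      have hMk : IsCbFamily 0 k fun p : ι × ℝ => M p.1 p.2 :=
        (hf.fderiv.mono le_rfl (by omega)).comp hYk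
      refine IsCbFamily.of_hasFDerivAt (D := fun p x => D p.1 x p.2) ?_ fun p x => hder p.1 p.2 x
      exact isCbFamily_of_linear (F := E →L[ℝ] E) hT k (M := M') (g := fun _ _ _ => 0)
        (J := fun i r x => D i x r) (J₀ := ContinuousLinearMap.id ℝ E)
        (IsCbFamily.clm_comp (ContinuousLinearMap.compL ℝ E E E) hMk)
        ⟨fun _ => contDiff_const, fun j _ _ => ⟨0, fun _ x => by
          rw [show (fun _ : E => (0 : E →L[ℝ] E)) = 0 from rfl]; simp⟩⟩
        hM'm (fun _ _ => stronglyMeasurable_const) hDm ⟨_, fun i r x => hDb i x r⟩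
        fun i t x => hD i x t
  exact ⟨fun i t x => Y i x t, hind _ le_rfl, hYm, fun i x => ⟨_, hYb i x⟩, fun i t x => hY i x t⟩

end Flow

-- Uniform families: constants, cutoffs, expectations.

universe v

namespace IsCbFamily

variable {θ E F : Type*} [NormedAddCommGroup E] [NormedSpace ℝ E]
    [NormedAddCommGroup F] [NormedSpace ℝ F]

/-- Orders start at `1`, so `c` may be unbounded; this permits translation by the reference paths.
-/
lemma const (k : ℕ) (c : θ → F) : IsCbFamily 1 k fun i (_ : E) => c i where
  contDiff _ := contDiff_const
  bounded j h1 _ := ⟨0, fun i x => by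
    rw [iteratedFDeriv_const_of_ne (by omega)]; simp⟩

lemma of_clm (k : ℕ) {A : θ → E →L[ℝ] F} {C : ℝ} (hA : ∀ i, ‖A i‖ ≤ C) :
    IsCbFamily 1 (k + 1) fun i x => A i x :=
  of_hasFDerivAt (D := fun i _ => A i) ((const k A).of_norm_le fun i _ => hA i)
    fun i _ => (A i).hasFDerivAt

lemma ite {l k : ℕ} {u : θ → E → F} (h : IsCbFamily l k u) (P : θ → Prop) [DecidablePred P] :
    IsCbFamily l k fun i x => if P i then u i x else 0 where
  contDiff i := by
    by_cases hi : P i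
    · simpa [hi] using h.contDiff i
    · simpa [hi] using contDiff_const
  bounded j h1 h2 := by
    obtain ⟨C, hC⟩ := h.bounded j h1 h2
    refine ⟨max C 0, fun i x => ?_⟩
    by_cases hi : P i
    · simpa [hi] using Or.inl (hC i x)
    · have : (fun _ : E => (0 : F)) = 0 := rfl
      simp [hi, this]

/-- Differentiation under the expectation. -/
lemma integral {Ω ι : Type*} [MeasurableSpace Ω] (μ : Measure Ω) [IsProbabilityMeasure μ]
    {E : Type v} [NormedAddCommGroup E] [NormedSpace ℝ E] [FiniteDimensional ℝ E] (k : ℕ) :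
    ∀ {F : Type v} [NormedAddCommGroup F] [NormedSpace ℝ F] {f : ι → Ω → E → F},
      (IsCbFamily 0 k fun p : ι × Ω => f p.1 p.2) →
      (∀ i x, StronglyMeasurable fun ω => f i ω x) →
      IsCbFamily 0 k fun i x => ∫ ω, f i ω x ∂μ := by
  induction k with
  | zero =>
    intro F _ _ f hf hm
    obtain ⟨C, hC0, hC⟩ := hf.exists_norm_le
    refine (of_continuous fun i => ?_).of_norm_le (C := C) fun i x => ?_
    · exact continuous_of_dominated (bound := fun _ => C)
        (fun x => (hm i x).aestronglyMeasurable)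
        (fun x => Eventually.of_forall fun ω => hC (i, ω) x) (integrable_const _)
        (Eventually.of_forall fun ω => hf.continuous (i, ω))
    · simpa using norm_integral_le_of_norm_le_const (μ := μ)
        (Eventually.of_forall fun ω => hC (i, ω) x)
  | succ k ih =>
    intro F _ _ f hf hm
    obtain ⟨C, hC0, hC⟩ := hf.exists_norm_le
    have hf' := hf.mono zero_le_one le_rfl
    obtain ⟨K, hK, hD, -⟩ := hf'.exists_lipschitz
    have hDm : ∀ i x, StronglyMeasurable fun ω => _root_.fderiv ℝ (f i ω) x := fun i =>
      stronglyMeasurable_fderiv (hm i) fun ω => hf'.differentiable (i, ω)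
    have hDk := ih (f := fun i ω => _root_.fderiv ℝ (f i ω)) hf'.fderiv hDm
    refine (of_hasFDerivAt hDk fun i x => ?_).of_norm_le (C := C) fun i x => ?_
    · exact hasFDerivAt_integral_of_dominated_of_fderiv_le (F := fun y ω => f i ω y)
        (F' := fun y ω => _root_.fderiv ℝ (f i ω) y) (bound := fun _ => K) (s := univ) univ_mem
        (Eventually.of_forall fun y => (hm i y).aestronglyMeasurable)
        (Integrable.of_bound (hm i x).aestronglyMeasurable C
          (Eventually.of_forall fun ω => hC (i, ω) x))
        (hDm i x).aestronglyMeasurable (Eventually.of_forall fun ω y _ => hD (i, ω) y)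
        (integrable_const _)
        (Eventually.of_forall fun ω y _ => (hf'.differentiable (i, ω) y).hasFDerivAt)
    · simpa using norm_integral_le_of_norm_le_const (μ := μ)
        (Eventually.of_forall fun ω => hC (i, ω) x)

end IsCbFamily

/-! ### Càdlàg paths -/

section Cadlag

variable {E : Type*} [NormedAddCommGroup E] {s T : ℝ} {f : ℝ → E}

/-- One-sided limits bound the path near each point, and compactness of `[s, T]` makes the bound
global. -/
lemma IsCadlagOn.exists_norm_le (hf : IsCadlagOn f (Icc s T)) :
    ∃ C, ∀ r ∈ Icc s T, ‖f r‖ ≤ C := by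
  refine isCompact_Icc.induction_on (p := fun S => ∃ C, ∀ r ∈ S, ‖f r‖ ≤ C)
    ⟨0, by simp⟩ (fun S S' h ⟨C, hC⟩ => ⟨C, fun r hr => hC r (h hr)⟩) ?_ ?_
  · rintro S S' ⟨C, hC⟩ ⟨D, hD⟩
    exact ⟨max C D, fun r hr => hr.elim (fun h => le_max_of_le_left (hC r h))
      fun h => le_max_of_le_right (hD r h)⟩
  · intro x hx
    obtain ⟨h1, l, h2⟩ := hf x hx
    have e1 : ∀ᶠ r in 𝓝[Icc s T ∩ Ioi x] x, ‖f r‖ ≤ ‖f x‖ + 1 :=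
      h1.norm.eventually_le_const (lt_add_one _)
    have e2 : ∀ᶠ r in 𝓝[Icc s T ∩ Iio x] x, ‖f r‖ ≤ ‖l‖ + 1 :=
      h2.norm.eventually_le_const (lt_add_one _)
    refine ⟨{r | ‖f r‖ ≤ max (‖f x‖ + 1) (‖l‖ + 1)}, ?_, _, fun r hr => hr⟩
    have hsub : Icc s T ⊆ (Icc s T ∩ Ioi x) ∪ (Icc s T ∩ Iio x) ∪ {x} := by
      intro r hr
      rcases lt_trichotomy r x with h | h | h
      · exact Or.inl (Or.inr ⟨hr, h⟩)
      · exact Or.inr h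
      · exact Or.inl (Or.inl ⟨hr, h⟩)
    refine nhdsWithin_mono x hsub ?_
    rw [nhdsWithin_union, nhdsWithin_union]
    refine ⟨⟨?_, ?_⟩, ?_⟩
    · filter_upwards [e1] with r hr using le_max_of_le_left hr
    · filter_upwards [e2] with r hr using le_max_of_le_right hr
    · rw [nhdsWithin_singleton]
      exact le_max_of_le_left (a := ‖f x‖) (by linarith)

lemma IsCadlagOn.stronglyMeasurable_indicator (hf : IsCadlagOn f (Icc s T)) :
    StronglyMeasurable ((Icc s T).indicator f) := by
  -- The grid point strictly to the right of `r`, capped at `T`. Composition with `q n` factors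
  -- through an integer, hence is measurable for any `f`, and right-continuity gives the limit.
  let q : ℕ → ℝ → ℝ := fun n r => min T ((⌊(n + 1 : ℝ) * r⌋ + 1) / (n + 1))
  refine stronglyMeasurable_of_tendsto (f := fun n => (Icc s T).indicator fun r => f (q n r))
    atTop (fun n => StronglyMeasurable.indicator ?_ measurableSet_Icc) ?_
  · have h1 : StronglyMeasurable fun z : ℤ => f (min T (((z : ℝ) + 1) / (n + 1))) :=
      StronglyMeasurable.of_discrete
    exact h1.comp_measurable (g := fun r : ℝ => ⌊(n + 1 : ℝ) * r⌋) (by fun_prop)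
  · refine tendsto_pi_nhds.2 fun r => ?_
    by_cases hr : r ∈ Icc s T
    · simp only [indicator_of_mem hr]
      have hlt : ∀ n : ℕ, r < (⌊(n + 1 : ℝ) * r⌋ + 1) / (n + 1) := fun n => by
        rw [lt_div_iff₀ (by positivity), mul_comm]
        exact Int.lt_floor_add_one _
      rcases hr.2.eq_or_lt with h | h
      · have : ∀ n, q n r = r := fun n => by
          simp only [q]
          rw [min_eq_left (h ▸ (hlt n).le), h]
        simp [this]
      · refine (hf r hr).1.tendsto.comp (tendsto_nhdsWithin_iff.2 ⟨?_, Eventually.of_forall ?_⟩)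
        · have h2 : Tendsto (fun n : ℕ => r + 1 / ((n : ℝ) + 1)) atTop (𝓝 r) := by
            simpa using (tendsto_one_div_add_atTop_nhds_zero_nat (𝕜 := ℝ)).const_add r
          refine tendsto_of_tendsto_of_tendsto_of_le_of_le tendsto_const_nhds h2
            (fun n => le_min h.le (hlt n).le) (fun n => (min_le_right _ _).trans ?_)
          have h3 : (0 : ℝ) < n + 1 := by positivity
          have h4 : (r + 1 / ((n : ℝ) + 1)) * (n + 1) = (n + 1) * r + 1 := by
            field_simp
          rw [div_le_iff₀ h3, h4]
          exact add_le_add_left (Int.floor_le _) _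
        · intro n
          have h2 : r < q n r := lt_min h (hlt n)
          exact ⟨⟨hr.1.trans h2.le, min_le_left _ _⟩, h2⟩
    · simp [indicator_of_notMem hr]

end Cadlag

/-! ### The equation along a path of the noise -/

/-- Uniqueness of bounded solutions of an integral equation on `[s, T]`. -/
lemma eqOn_of_integral_eq {F : Type*} [NormedAddCommGroup F] [NormedSpace ℝ F] {K s T : ℝ}
    (hK : 0 ≤ K) {f : ℝ → F → F} (hL : ∀ r y z, ‖f r y - f r z‖ ≤ K * ‖y - z‖)
    (h0 : ∀ r ∉ Icc s T, ∀ y, f r y = 0) {x : F} {U V : ℝ → F} (hU : StronglyMeasurable U)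
    (hV : StronglyMeasurable V) {c d : ℝ} (hc : ∀ r, ‖U r‖ ≤ c) (hd : ∀ r, ‖V r‖ ≤ d)
    (hUi : Integrable (fun r => f r (U r)) (timeMeasure T))
    (hVi : Integrable (fun r => f r (V r)) (timeMeasure T))
    (hUe : ∀ t ∈ Icc s T, U t = x + ∫ r in Iic t, f r (U r) ∂(timeMeasure T))
    (hVe : ∀ t ∈ Icc s T, V t = x + ∫ r in Iic t, f r (V r) ∂(timeMeasure T)) :
    EqOn U V (Icc s T) := by
  -- The cutoff turns the equation on `[s, T]` into an inequality at all times, to which Grönwall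
  -- applies with `a = 0`.
  let u : ℝ → ℝ := (Icc s T).indicator fun r => ‖U r - V r‖
  have hu : StronglyMeasurable u := (hU.sub hV).norm.indicator measurableSet_Icc
  have hu0 : ∀ r, 0 ≤ u r := fun r => indicator_nonneg (fun _ _ => norm_nonneg _) r
  have huc : ∀ r, |u r| ≤ c + d := fun r => by
    rw [abs_of_nonneg (hu0 r)]
    refine (indicator_le_self' (fun _ _ => norm_nonneg _) r).trans ?_
    exact (norm_sub_le _ _).trans (add_le_add (hc r) (hd r))
  have hui : Integrable u (timeMeasure T) :=
    Integrable.of_bound hu.aestronglyMeasurable _ (Eventually.of_forall huc)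
  have key := le_of_le_add_integral (T := T) hK le_rfl hu.aestronglyMeasurable huc fun t => by
    rw [zero_add]
    by_cases ht : t ∈ Icc s T
    · rw [← integral_const_mul]
      simp only [u, indicator_of_mem ht]
      rw [hUe t ht, hVe t ht, add_sub_add_left_eq_sub,
        ← integral_sub hUi.integrableOn hVi.integrableOn]
      refine norm_integral_le_of_norm_le (hui.const_mul K).integrableOn
        (Eventually.of_forall fun r => ?_)
      by_cases hr : r ∈ Icc s T
      · simpa only [u, indicator_of_mem hr] using hL r _ _
      · simp [h0 r hr, indicator_of_notMem hr]
    · simp only [u, indicator_of_notMem ht]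
      exact mul_nonneg hK (integral_nonneg hu0)
  intro t ht
  have h1 := key t
  simp only [u, indicator_of_mem ht, mul_zero, zero_mul] at h1
  exact sub_eq_zero.1 (norm_le_zero_iff.1 h1)

/-! ### Cancellation of the noise along a path. -/

section PathwiseFlow

variable {E : Type*} [NormedAddCommGroup E] [NormedSpace ℝ E] {T : ℝ}

/-- The drift `B`, frozen outside `[0, T]`. -/
noncomputable def frozenDrift {E : Type*} {T : ℝ} (hT : 0 ≤ T) (B : ℝ → E → E) (r : ℝ) : E → E :=
  B (projIcc 0 T hT r)

lemma frozenDrift_of_mem {E : Type*} {T : ℝ} (hT : 0 ≤ T) (B : ℝ → E → E) {r : ℝ} (hr : r ∈ Icc 0 T) :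
    frozenDrift hT B r = B r := by
  rw [frozenDrift, projIcc_of_mem hT hr]

lemma IsCbZero.isCbFamily_frozenDrift {n : ℕ} {B : ℝ → E → E} (hB : IsCbZero n T B)
    (hT : 0 ≤ T) : IsCbFamily 0 n (frozenDrift hT B) where
  contDiff r := hB.contDiff _ (projIcc 0 T hT r).2
  bounded j _ h2 := by
    obtain ⟨C, hC⟩ := hB.bounded j h2
    exact ⟨C, fun r x => hC _ (projIcc 0 T hT r).2 x⟩

lemma IsCbZero.continuous_frozenDrift {n : ℕ} {B : ℝ → E → E} (hB : IsCbZero n T B)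
    (hT : 0 ≤ T) : Continuous fun p : ℝ × E => frozenDrift hT B p.1 p.2 := by
  have h : Continuous fun p : ℝ × E => ((projIcc 0 T hT p.1 : ℝ), p.2) :=
    (continuous_subtype_val.comp (continuous_projIcc.comp continuous_fst)).prodMk continuous_snd
  exact hB.continuousOn.comp_continuous h fun p => ⟨(projIcc 0 T hT p.1).2, mem_univ _⟩

/-- Initial times and measurable reference paths. -/
def PathIndex (E : Type*) [TopologicalSpace E] (T : ℝ) : Type _ :=
  {p : ℝ × (ℝ → E) // p.1 ∈ Icc 0 T ∧ StronglyMeasurable p.2}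

open Classical in
/-- The vector field satisfied by the difference between a solution and the reference path. -/
noncomputable def pathField (hT : 0 ≤ T) (A : E →L[ℝ] E) (B : ℝ → E → E)
    (i : PathIndex E T) (r : ℝ) (y : E) : E :=
  if r ∈ Ioc i.1.1 T then
    A y + (frozenDrift hT B r (i.1.2 r + y) - frozenDrift hT B r (i.1.2 r)) else 0

lemma isCbFamily_pathField {n : ℕ} {B : ℝ → E → E} (hB : IsCbZero (n + 1) T B)
    (hT : 0 ≤ T) (A : E →L[ℝ] E) :
    IsCbFamily 1 (n + 1) fun p : PathIndex E T × ℝ => pathField hT A B p.1 p.2 := by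
  classical
  have h1 : IsCbFamily 1 (n + 1) fun (_ : PathIndex E T × ℝ) (y : E) => A y :=
    IsCbFamily.of_clm n (A := fun _ => A) (C := ‖A‖) fun _ => le_rfl
  have h2 : IsCbFamily 1 (n + 1) fun (p : PathIndex E T × ℝ) (y : E) => p.1.1.2 p.2 + y :=
    (IsCbFamily.const (n + 1) fun p : PathIndex E T × ℝ => p.1.1.2 p.2).add
      (IsCbFamily.of_clm n (A := fun _ => ContinuousLinearMap.id ℝ E) (C := 1)
        fun _ => ContinuousLinearMap.norm_id_le)
  have h3 := (((hB.isCbFamily_frozenDrift hT).reindex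
    fun p : PathIndex E T × ℝ => p.2).comp h2).mono zero_le_one le_rfl
  have h4 := h1.add (h3.add (IsCbFamily.const (n + 1) fun p : PathIndex E T × ℝ =>
    -frozenDrift hT B p.2 (p.1.1.2 p.2)))
  have h5 := h4.ite fun p : PathIndex E T × ℝ => p.2 ∈ Ioc p.1.1.1 T
  simp only [← sub_eq_add_neg] at h5
  convert h5 using 3
  simp only [pathField]

lemma pathField_zero (hT : 0 ≤ T) (A : E →L[ℝ] E) (B : ℝ → E → E) (i : PathIndex E T) (r : ℝ) :
    pathField hT A B i r 0 = 0 := by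
  simp [pathField]

lemma stronglyMeasurable_pathField {n : ℕ} {B : ℝ → E → E} (hB : IsCbZero n T B)
    (hT : 0 ≤ T) (A : E →L[ℝ] E) (i : PathIndex E T) {y : ℝ → E} (hy : StronglyMeasurable y) :
    StronglyMeasurable fun r => pathField hT A B i r (y r) := by
  classical
  have h1 := hB.continuous_frozenDrift hT
  have hid : StronglyMeasurable fun r : ℝ => r := stronglyMeasurable_id
  have h2 : StronglyMeasurable fun r =>
      A (y r) + (frozenDrift hT B r (i.1.2 r + y r) - frozenDrift hT B r (i.1.2 r)) :=
    (A.continuous.comp_stronglyMeasurable hy).add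
      ((h1.comp_stronglyMeasurable (hid.prodMk (i.2.2.add hy))).sub
        (h1.comp_stronglyMeasurable (hid.prodMk i.2.2)))
  have h3 : (fun r => pathField hT A B i r (y r)) = (Ioc i.1.1 T).indicator fun r =>
      A (y r) + (frozenDrift hT B r (i.1.2 r + y r) - frozenDrift hT B r (i.1.2 r)) := by
    funext r
    simp only [pathField, indicator_apply]
  rw [h3]
  exact h2.indicator measurableSet_Ioc

/-- The drift of the equation is integrable along càdlàg paths. -/
lemma integrableOn_drift {n : ℕ} {B : ℝ → E → E} (hB : IsCbZero n T B)
    (hT : 0 ≤ T) (A : E →L[ℝ] E) {s : ℝ} (hs : 0 ≤ s) {η : ℝ → E}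
    (hη : IsCadlagOn η (Icc s T)) :
    IntegrableOn (fun r => A (η r) + B r (η r)) (Ioc s T) := by
  obtain ⟨c, hc⟩ := hη.exists_norm_le
  obtain ⟨C, hC0, hC⟩ := (hB.isCbFamily_frozenDrift hT).exists_norm_le
  have hm := hη.stronglyMeasurable_indicator
  have hid : StronglyMeasurable fun r : ℝ => r := stronglyMeasurable_id
  refine IntegrableOn.congr_fun (f := fun r => A ((Icc s T).indicator η r)
    + frozenDrift hT B r ((Icc s T).indicator η r)) ?_ (fun r hr => ?_) measurableSet_Ioc
  · refine Measure.integrableOn_of_bounded (M := ‖A‖ * c + C) (by simp)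
      ((A.continuous.comp_stronglyMeasurable hm).add ((hB.continuous_frozenDrift hT
        ).comp_stronglyMeasurable (hid.prodMk hm))).aestronglyMeasurable
      ((ae_restrict_mem measurableSet_Ioc).mono fun r hr => (norm_add_le _ _).trans ?_)
    gcongr
    · refine (A.le_opNorm _).trans ?_
      rw [indicator_of_mem (Ioc_subset_Icc_self hr)]
      gcongr
      exact hc r (Ioc_subset_Icc_self hr)
    · exact hC r _
  · simp only [indicator_of_mem (Ioc_subset_Icc_self hr),
      frozenDrift_of_mem hT B (⟨hs.trans hr.1.le, hr.2⟩ : r ∈ Icc 0 T)]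

/-- A reference path, set to zero outside `[s, T]` and replaced by zero if it is not càdlàg. -/
noncomputable def referencePath {E : Type*} [NormedAddCommGroup E] (s T : ℝ) (ξ : ℝ → E) : ℝ → E :=
  open Classical in if IsCadlagOn ξ (Icc s T) then (Icc s T).indicator ξ else 0

lemma stronglyMeasurable_referencePath {E : Type*} [NormedAddCommGroup E] (s T : ℝ) (ξ : ℝ → E) :
    StronglyMeasurable (referencePath s T ξ) := by
  unfold referencePath
  split_ifs with h
  · exact h.stronglyMeasurable_indicator
  · exact stronglyMeasurable_zero

/-- The index of a reference path. -/
noncomputable def pathIndex {s : ℝ} (hs : s ∈ Icc 0 T) (ξ : ℝ → E) : PathIndex E T :=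
  ⟨(s, referencePath s T ξ), hs, stronglyMeasurable_referencePath s T ξ⟩

/-- Two solutions driven by the same noise differ by the flow of `pathField`. -/
lemma eq_add_flow [FiniteDimensional ℝ E] {n : ℕ} {B : ℝ → E → E} (hB : IsCbZero (n + 1) T B)
    (hT : 0 ≤ T) (A : E →L[ℝ] E) {s : ℝ} (hs : s ∈ Icc 0 T) {ξ η z : ℝ → E}
    (hξ : IsCadlagOn ξ (Icc s T)) (hη : IsCadlagOn η (Icc s T)) {x : E}
    (hξe : ∀ t ∈ Icc s T, ξ t = 0 + (∫ r in s..t, (A (ξ r) + B r (ξ r))) + z t)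
    (hηe : ∀ t ∈ Icc s T, η t = x + (∫ r in s..t, (A (η r) + B r (η r))) + z t)
    {V : ℝ → E} (hVm : StronglyMeasurable V) (hVb : ∃ c, ∀ r, ‖V r‖ ≤ c)
    (hV : ∀ t, V t = x + ∫ r in Iic t, pathField hT A B (pathIndex hs ξ) r (V r) ∂(timeMeasure T))
    {t : ℝ} (ht : t ∈ Icc s T) : η t = referencePath s T ξ t + V t := by
  obtain ⟨K, hK, -, hL⟩ := (isCbFamily_pathField hB hT A).exists_lipschitz
  have hL' : ∀ r y z, ‖pathField hT A B (pathIndex hs ξ) r y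
      - pathField hT A B (pathIndex hs ξ) r z‖ ≤ K * ‖y - z‖ := fun r y z =>
    hL (pathIndex hs ξ, r) z y
  have href : referencePath s T ξ = (Icc s T).indicator ξ := if_pos hξ
  let U : ℝ → E := fun r => (Icc s T).indicator η r - (Icc s T).indicator ξ r
  have hUm : StronglyMeasurable U :=
    hη.stronglyMeasurable_indicator.sub hξ.stronglyMeasurable_indicator
  obtain ⟨a, ha⟩ := hξ.exists_norm_le
  obtain ⟨b, hb⟩ := hη.exists_norm_le
  obtain ⟨d, hd⟩ := hVb
  have ha0 : 0 ≤ a := (norm_nonneg _).trans (ha t ht)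
  have hb0 : 0 ≤ b := (norm_nonneg _).trans (hb t ht)
  have hUb : ∀ r, ‖U r‖ ≤ b + a := fun r => by
    refine (norm_sub_le _ _).trans ?_
    by_cases hr : r ∈ Icc s T
    · simp only [indicator_of_mem hr]
      exact add_le_add (hb r hr) (ha r hr)
    · simp only [indicator_of_notMem hr, norm_zero]
      linarith
  have hint : ∀ {Z : ℝ → E} {c : ℝ}, StronglyMeasurable Z → (∀ r, ‖Z r‖ ≤ c) →
      Integrable (fun r => pathField hT A B (pathIndex hs ξ) r (Z r)) (timeMeasure T) := by
    intro Z c hZ hc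
    refine Integrable.of_bound
      (stronglyMeasurable_pathField hB hT A _ hZ).aestronglyMeasurable (K * c)
      (Eventually.of_forall fun r => ?_)
    have := hL' r (Z r) 0
    rw [pathField_zero, sub_zero, sub_zero] at this
    exact this.trans (by gcongr; exact hc r)
  -- Subtracting the two equations removes the noise `z`.
  have hUe : ∀ t ∈ Icc s T, U t = x
      + ∫ r in Iic t, pathField hT A B (pathIndex hs ξ) r (U r) ∂(timeMeasure T) := by
    intro t ht
    have h1 : ∫ r in Iic t, pathField hT A B (pathIndex hs ξ) r (U r) ∂(timeMeasure T)
        = ∫ r in Ioc s t, ((A (η r) + B r (η r)) - (A (ξ r) + B r (ξ r))) := by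
      have h2 : (fun r => pathField hT A B (pathIndex hs ξ) r (U r)) = (Ioc s T).indicator
          fun r => (A (η r) + B r (η r)) - (A (ξ r) + B r (ξ r)) := by
        funext r
        by_cases hr : r ∈ Ioc s T
        · have hr' := Ioc_subset_Icc_self hr
          have hr0 : r ∈ Icc 0 T := ⟨hs.1.trans hr'.1, hr'.2⟩
          simp only [pathField, pathIndex, href, U, hr, indicator_of_mem, hr', if_true,
            frozenDrift_of_mem hT B hr0, add_sub_cancel, map_sub]
          abel
        · simp only [pathField, pathIndex, hr, if_false, indicator_of_notMem, not_false_iff]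
      rw [h2, timeMeasure_restrict_Iic, min_eq_left ht.2, setIntegral_indicator measurableSet_Ioc,
        Ioc_inter_Ioc, sup_eq_right.2 hs.1, inf_eq_left.2 ht.2]
    have hsub : Ioc s t ⊆ Ioc s T := Ioc_subset_Ioc_right ht.2
    rw [h1, integral_sub ((integrableOn_drift hB hT A hs.1 hη).mono_set hsub)
      ((integrableOn_drift hB hT A hs.1 hξ).mono_set hsub),
      ← intervalIntegral.integral_of_le ht.1, ← intervalIntegral.integral_of_le ht.1]
    simp only [U, indicator_of_mem ht]
    rw [hξe t ht, hηe t ht]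
    abel
  have := eqOn_of_integral_eq hK hL' (fun r hr y => if_neg fun h => hr (Ioc_subset_Icc_self h))
    hUm hVm hUb hd (hint hUm hUb) (hint hVm hd) hUe (fun t _ => hV t) ht
  rw [href, ← this]
  simp only [U, indicator_of_mem ht, add_sub_cancel]

end PathwiseFlow

/-! ### Measurability of the noise and the transition operators -/

section Noise

variable {Ω : Type*} [MeasurableSpace Ω] {μ : Measure Ω} [μ.IsComplete]

/-- A process with almost surely continuous paths can be evaluated at a random time. -/
lemma measurable_comp_random_time {b : ℝ≥0 → Ω → ℝ} (hb : ∀ t, AEMeasurable (b t) μ)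
    (hc : ∀ᵐ ω ∂μ, Continuous fun t => b t ω) {τ : Ω → ℝ≥0} (hτ : Measurable τ) :
    Measurable fun ω => b (τ ω) ω := by
  classical
  -- Discontinuous paths are replaced by `0`. The modification changes values only on a null set, so
  -- completeness yields its measurability.
  let S : Set Ω := {ω | Continuous fun t => b t ω}
  let b' : ℝ≥0 → Ω → ℝ := fun t ω => if ω ∈ S then b t ω else 0
  have hbb' : ∀ᵐ ω ∂μ, ∀ t, b t ω = b' t ω := by
    filter_upwards [hc] with ω hω t
    exact (if_pos (show ω ∈ S from hω)).symm
  have hb'm : ∀ t, Measurable (b' t) := fun t =>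
    aemeasurable_iff_measurable.1 ((hb t).congr (hbb'.mono fun ω h => h t))
  have hb'c : ∀ ω, Continuous fun t => b' t ω := fun ω => by
    by_cases h : ω ∈ S
    · simpa only [b', if_pos h] using (show Continuous fun t => b t ω from h)
    · simpa only [b', if_neg h] using continuous_const
  have h1 : Measurable fun ω => b' (τ ω) ω :=
    (measurable_uncurry_of_continuous_of_measurable hb'c hb'm).comp (hτ.prodMk measurable_id)
  exact h1.congr_ae (hbb'.mono fun ω h => (h _).symm)

lemma IsNoise.measurable_subordinated {N : ℕ} {α : ℝ} {β : Fin N → ℝ≥0 → Ω → ℝ}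
    {L : ℝ≥0 → Ω → ℝ≥0} (h : IsNoise α β L μ) (t : ℝ≥0) : Measurable (subordinated β L t) := by
  have hL : Measurable (L t) := by
    have := (h.subordinator.levy.measurable t).real_toNNReal
    simpa using this
  refine (WithLp.measurable_toLp 2 _).comp (measurable_pi_lambda _ fun i => ?_)
  exact measurable_comp_random_time (fun t => (h.brownian i).aemeasurable t) (h.brownian i).cont hL

/-- Completeness makes the adjoined negligible sets measurable, so adapted variables are measurable.
-/
lemma augmentedFiltration_le {E : Type*} [m : MeasurableSpace E] {Z : ℝ≥0 → Ω → E}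
    (hZ : ∀ t, Measurable (Z t)) (t : ℝ≥0) :
    augmentedFiltration Z μ t ≤ (inferInstance : MeasurableSpace Ω) :=
  sup_le (iSup_le fun u => (hZ u).comap_le)
    (MeasurableSpace.generateFrom_le fun _ hS => measurableSet_of_null hS)

end Noise

/-! ### Norm bounds and the conclusion. -/

lemma norm_partialDeriv_le {N h : ℕ} (j : Fin h → Fin N) (f : EuclideanSpace ℝ (Fin N) → ℝ)
    (x : EuclideanSpace ℝ (Fin N)) : ‖partialDeriv j f x‖ ≤ ‖iteratedFDeriv ℝ h f x‖ := by
  refine (ContinuousMultilinearMap.le_opNorm _ _).trans ?_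
  simp

lemma supNorm_le {E : Type*} {f : E → ℝ} {C : ℝ} (h : ∀ x, ‖f x‖ ≤ C) :
    supNorm f ≤ ENNReal.ofReal C :=
  iSup_le fun x => by
    rw [← ofReal_norm]
    exact ENNReal.ofReal_le_ofReal (h x)

lemma IsCbFamily.exists_cbNorm_le {θ : Type*} {N n : ℕ}
    {u : θ → EuclideanSpace ℝ (Fin N) → ℝ} (h : IsCbFamily 0 n u) :
    ∃ C < ⊤, ∀ i, cbNorm n (u i) ≤ C := by
  obtain ⟨C, -, hC⟩ := h.exists_bound
  refine ⟨ENNReal.ofReal C + ∑ _i ∈ Finset.Icc 1 n, ENNReal.ofReal C,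
    ENNReal.add_lt_top.2 ⟨ENNReal.ofReal_lt_top, ENNReal.sum_lt_top.2 fun _ _ =>
      ENNReal.ofReal_lt_top⟩, fun i => add_le_add (supNorm_le fun x => ?_)
      (Finset.sum_le_sum fun j hj => iSup_le fun l => supNorm_le fun x => ?_)⟩
  · simpa using hC 0 le_rfl (Nat.zero_le _) i x
  · exact (norm_partialDeriv_le _ _ _).trans
      (hC j (Nat.zero_le _) (Finset.mem_Icc.1 hj).2 i x)

/-- The functions `P_{s,t} φ`, `0 ≤ s ≤ t ≤ T`, have uniformly bounded derivatives. -/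
lemma isCbFamily_transitionOp {Ω : Type*} [MeasurableSpace Ω] (μ : Measure Ω)
    [IsProbabilityMeasure μ] [μ.IsComplete] {N : ℕ} {Z : ℝ≥0 → Ω → EuclideanSpace ℝ (Fin N)}
    (hZ : ∀ t, Measurable (Z t)) (lam σ : Fin N → ℝ) {T : ℝ} (hT : 0 ≤ T) {n : ℕ}
    {B : ℝ → EuclideanSpace ℝ (Fin N) → EuclideanSpace ℝ (Fin N)} (hB : IsCbZero (n + 1) T B)
    {X : ℝ → EuclideanSpace ℝ (Fin N) → ℝ → Ω → EuclideanSpace ℝ (Fin N)}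
    (hX : ∀ s ∈ Icc 0 T, ∀ x, IsSDESolution μ Z lam σ B T s x (X s x))
    {φ : EuclideanSpace ℝ (Fin N) → ℝ} (hφ : IsCb (n + 1) φ) :
    IsCbFamily 0 (n + 1) fun p : {p : ℝ × ℝ // p.1 ∈ Icc 0 T ∧ p.2 ∈ Icc p.1 T} =>
      transitionOp μ X p.1.1 p.1.2 φ := by
  set A := diagOp fun i => -lam i with hA
  obtain ⟨Y, hYk, hYm, hYb, hY⟩ := exists_flow hT (isCbFamily_pathField hB hT A)
    (fun i r => pathField_zero hT A B i r)
    fun i x => stronglyMeasurable_pathField hB hT A i stronglyMeasurable_const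
  let J := {p : ℝ × ℝ // p.1 ∈ Icc 0 T ∧ p.2 ∈ Icc p.1 T}
  let ref : J → Ω → ℝ → EuclideanSpace ℝ (Fin N) := fun p ω =>
    referencePath p.1.1 T fun r => X p.1.1 0 r ω
  let idx : J → Ω → PathIndex (EuclideanSpace ℝ (Fin N)) T := fun p ω =>
    pathIndex p.2.1 fun r => X p.1.1 0 r ω
  let g : J → Ω → EuclideanSpace ℝ (Fin N) → ℝ := fun p ω x =>
    φ (ref p ω p.1.2 + Y (idx p ω) p.1.2 x)
  have hφ' : IsCbFamily 0 (n + 1) fun _ : J × Ω => φ :=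
    ⟨fun _ => hφ.contDiff, fun j _ h2 => (hφ.bounded j h2).imp fun _ hC _ => hC⟩
  have hg : IsCbFamily 0 (n + 1) fun q : J × Ω => g q.1 q.2 :=
    hφ'.comp ((IsCbFamily.const (n + 1) fun q : J × Ω => ref q.1 q.2 q.1.1.2).add
      (hYk.reindex fun q : J × Ω => (idx q.1 q.2, q.1.1.2)))
  -- The null set may depend on `x`. This is harmless: `g p ω` is smooth for every `ω`, and the
  -- identity is used only inside the expectation at fixed `x`.
  have hae : ∀ (p : J) x, (fun ω => φ (X p.1.1 x p.1.2 ω)) =ᵐ[μ] fun ω => g p ω x := by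
    rintro ⟨⟨s, t⟩, hs, ht⟩ x
    filter_upwards [(hX s hs 0).cadlag, (hX s hs 0).equation, (hX s hs x).cadlag,
      (hX s hs x).equation] with ω h1 h2 h3 h4
    exact congrArg φ (eq_add_flow hB hT A hs h1 h3 h2 h4
      (hYm _ x) (hYb _ x) (fun t => hY _ t x) ht)
  -- Measurability in `ω` is not derived from the dependence of the flow on its reference path; it
  -- is transferred from the adapted solution by almost sure equality and completeness.
  have hgm : ∀ (p : J) x, StronglyMeasurable fun ω => g p ω x := by
    intro p x
    have h1 : Measurable (X p.1.1 x p.1.2) :=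
      ((hX p.1.1 p.2.1 x).adapted p.1.2 p.2.2).mono (augmentedFiltration_le hZ _) le_rfl
    have h2 : Measurable fun ω => φ (X p.1.1 x p.1.2 ω) :=
      hφ.contDiff.continuous.measurable.comp h1
    exact (h2.congr_ae (hae p x)).stronglyMeasurable
  have := IsCbFamily.integral μ (n + 1) hg hgm
  convert this using 3 with p x
  exact integral_congr_ae (hae p x)

theorem corollary3p3 {Ω : Type*} [MeasurableSpace Ω] (μ : Measure Ω) [IsProbabilityMeasure μ]
    [μ.IsComplete] {N : ℕ} (α : ℝ) (hα : α ∈ Ioo (0 : ℝ) 1)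
    (β : Fin N → ℝ≥0 → Ω → ℝ) (L : ℝ≥0 → Ω → ℝ≥0) (hnoise : IsNoise α β L μ)
    (lam σ : Fin N → ℝ) (hlam : ∀ i, 0 < lam i) (hσ : ∀ i, 0 < σ i)
    (T : ℝ) (hT : 0 < T) (n : ℕ) (hn : 2 ≤ n)
    (B₀ : ℝ → EuclideanSpace ℝ (Fin N) → EuclideanSpace ℝ (Fin N)) (hB₀ : IsCbZero n T B₀)
    (X : ℝ → EuclideanSpace ℝ (Fin N) → ℝ → Ω → EuclideanSpace ℝ (Fin N))
    (hX : ∀ s ∈ Icc 0 T, ∀ x, IsSDESolution μ (subordinated β L) lam σ B₀ T s x (X s x))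
    (φ : EuclideanSpace ℝ (Fin N) → ℝ) (hφ : IsCb n φ) :
    (∀ s t : ℝ, 0 ≤ s → s ≤ t → t ≤ T → IsCb n (transitionOp μ X s t φ)) ∧
      (⨆ s ∈ Icc 0 T, ⨆ t ∈ Icc s T, cbNorm n (transitionOp μ X s t φ)) < ⊤ := by
  -- At least one bounded derivative is needed for the Lipschitz estimate.
  obtain ⟨m, rfl⟩ : ∃ m, n = m + 1 := ⟨n - 1, by omega⟩
  have h := isCbFamily_transitionOp μ hnoise.measurable_subordinated lam σ hT.le hB₀ hX hφ
  refine ⟨fun s t hs hst ht => ?_, ?_⟩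
  · let p : {p : ℝ × ℝ // p.1 ∈ Icc 0 T ∧ p.2 ∈ Icc p.1 T} :=
      ⟨(s, t), ⟨hs, hst.trans ht⟩, hst, ht⟩
    exact ⟨h.contDiff p, fun i hi => (h.bounded i (Nat.zero_le _) hi).imp fun _ hC => hC p⟩
  · obtain ⟨C, hC, hle⟩ := h.exists_cbNorm_le
    exact (iSup₂_le fun s hs => iSup₂_le fun t ht => hle ⟨(s, t), hs, ht⟩).trans_lt hC
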